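/- Let $n\ge 2$, let $B_n$ be Artin's braid group with generators $\sigma_1,\dots,\sigma_{n-1}$, and let $B_n^+\subset B_n$ be the submonoid generated by $\sigma_1,\dots,\sigma_{n-1}$ (positive braids). Write $Sh^s(\sigma_i)=\sigma_{i-s}$ (shift) and $D(\sigma_i)=\sigma_{n-i}$ (flip), also letter by letter on positive words. $B_S^+$ is the submonoid generated by the $\sigma_i$ with $i\in S$. **Codes for the Dehornoy ordering $<_D$** (the normal finite Thurston type ordering whose curve diagram has the trivial permutation $k(i)=i$). A code of the $2$-braid word $\sigma_1^a$ is the number $a$. For $n\ge 3$, decompose a positive $n$-braid word $W$ into subwords as $W=A_m\cdots A_1A_0X_1X_2\cdots X_{n-2}$ (empty subwords allowed), where $A_i$ is a word in $\sigma_1,\dots,\sigma_{n-2}$ for odd $i$, a word in $\sigma_2,\dots,\sigma_{n-1}$ for even $i\ge 0$, and $X_j$ is a word in $\sigma_{j+1},\dots,\sigma_{n-1}$. Choose codes, recursively and with respect to the Dehornoy orderings, $\mathcal C_i$ of the $(n-1)$-braid word $D^{i-1}(A_i)$ for $i\ge 1$, $\mathcal C_0$ of the $(n-1)$-braid word $Sh(A_0)$,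 and $\mathcal C_{-j}$ of the $(n-j)$-braid word $Sh^{j}(X_j)$ for $1\le j\le n-2$. The resulting code of $W$ is $(\dots,\mathcal C_1,\mathcal C_0,\mathcal C_{-1},\dots,\mathcal C_{-(n-2)})$, a left-infinite sequence with $\mathcal C_i$ the code of the empty word for $i>m$. Codes are compared by $<_{\mathsf{right}}$: for $n=2$ this is the order of numbers, and for $n\ge 3$, $\mathcal C<_{\mathsf{right}}\mathcal C'$ if for some $l$ one has $\mathcal C_i=\mathcal C_i'$ for all $i<l$ and $\mathcal C_l<_{\mathsf{right}}\mathcal C'_l$. A *$\mathcal C$-normal form* of $\beta\in B_n^+$ with respect to $<_D$ is a positive word representing $\beta$ that has a code which is the $<_{\mathsf{right}}$-greatest among all codes of all positive words representing $\beta$. **$\Phi$-normal form** (alternating normal form). The maximal right divisor $\beta\wedge B_S^+$ of $\beta\in B_n^+$ is the element $\beta'\in B_S^+$ with $\beta\beta'^{-1}\in B_n^+$ such that $\beta'\beta''^{-1}\in B_S^+$ for every $\beta''\in B_S^+$ with $\beta\beta''^{-1}\in B_n^+$. Put $I=\{2,\dots,n-1\}$ and $J=\{1,\dots,n-2\}$.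 For $n=2$ the $\Phi$-normal form of $\sigma_1^a$ is the word $\sigma_1^a$. For $n\ge 3$ let $\beta=\beta_m\cdots\beta_1\beta_0$, where $\beta_i=(\beta\beta_0^{-1}\beta_1^{-1}\cdots\beta_{i-1}^{-1})\wedge B_I^+$ for even $i$ and $\beta_i=(\beta\beta_0^{-1}\beta_1^{-1}\cdots\beta_{i-1}^{-1})\wedge B_J^+$ for odd $i$. Identify $\beta_i$ with an $(n-1)$-braid by $Sh$ if $i=0$, by the identity if $i$ is odd, and by $D$ if $i>0$ is even; take the $\Phi$-normal forms of these $(n-1)$-braids, carry them back to words $w_m,\dots,w_0$ representing $\beta_m,\dots,\beta_0$; the $\Phi$-normal form of $\beta$ is $w_m\cdots w_1w_0$. **Proposition.** Every $\beta\in B_n^+$ has exactly one $\mathcal C$-normal form with respect to $<_D$ and exactly one $\Phi$-normal form, and these two positive words coincide. -/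

import Mathlib

/-! ### Braid groups, positive braids, words -/

/-- The defining relators of the braid group on `n` strands; the element `i : Fin (n - 1)`
stands for the generator `σ_{i+1}`. -/
def braidRels (n : ℕ) : Set (FreeGroup (Fin (n - 1))) :=
  {r | ∃ i j : Fin (n - 1), (i : ℕ) + 2 ≤ (j : ℕ) ∧
      r = FreeGroup.of i * FreeGroup.of j * (FreeGroup.of j * FreeGroup.of i)⁻¹} ∪
  {r | ∃ i j : Fin (n - 1), (i : ℕ) + 1 = (j : ℕ) ∧
      r = FreeGroup.of i * FreeGroup.of j * FreeGroup.of i *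
        (FreeGroup.of j * FreeGroup.of i * FreeGroup.of j)⁻¹}

/-- Artin's braid group `B_n`. -/
abbrev BraidGroup (n : ℕ) : Type := PresentedGroup (braidRels n)

/-- The generator `σ_i` of `B_n` for `1 ≤ i ≤ n - 1` (and `1` for all other `i`). -/
def braidGen (n i : ℕ) : BraidGroup n :=
  if h : 1 ≤ i ∧ i < n then PresentedGroup.of (⟨i - 1, by omega⟩ : Fin (n - 1)) else 1

/-- `B_S^+`, the submonoid of `B_n` generated by the `σ_i` with `i ∈ S`. -/
def parabolicMonoid (n : ℕ) (S : Set ℕ) : Submonoid (BraidGroup n) :=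
  Submonoid.closure (braidGen n '' S)

/-- The positive braid monoid `B_n^+`, generated in `B_n` by `σ_1, …, σ_{n-1}`. -/
def positiveBraidMonoid (n : ℕ) : Submonoid (BraidGroup n) :=
  parabolicMonoid n (Set.Ico 1 n)

/-- A positive braid word: the letter `i` stands for `σ_i`. -/
abbrev BraidWord : Type := List ℕ

/-- All letters of `w` lie in `S`. -/
def BraidWord.LettersIn (w : BraidWord) (S : Set ℕ) : Prop := ∀ l ∈ w, l ∈ S

/-- The element of `B_n` represented by a positive word. -/
def wordBraid (n : ℕ) (w : BraidWord) : BraidGroup n := (w.map (braidGen n)).prod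

/-- `w` is a positive `n`-braid word that represents `β`. -/
def IsPositiveRep (n : ℕ) (β : BraidGroup n) (w : BraidWord) : Prop :=
  w.LettersIn (Set.Ico 1 n) ∧ wordBraid n w = β

/-- The flip `D(σ_i) = σ_{n-i}` on positive `n`-braid words. -/
def flipWord (n : ℕ) (w : BraidWord) : BraidWord := w.map (fun l => n - l)

/-- The `s`-fold shift `σ_i ↦ σ_{i-s}`; it is only applied to words with letters `> s`. -/
def shiftWord (s : ℕ) (w : BraidWord) : BraidWord := w.map (fun l => l - s)

/-- The letters allowed in the block of index `i ≥ 0`: `σ_1, …, σ_{n-2}` for odd `i`,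
and `σ_2, …, σ_{n-1}` for even `i`. -/
def blockLetters (n i : ℕ) : Set ℕ :=
  if Odd i then Set.Ico 1 (n - 1) else Set.Ico 2 n

/-- The word `A_m A_{m-1} ⋯ A_1 A_0`. -/
def concatBlocks (A : ℕ → BraidWord) (m : ℕ) : BraidWord :=
  ((List.range (m + 1)).reverse.map A).flatten

/-! ### Normal finite Thurston type orderings

A normal finite Thurston type ordering of `B_n` is given by a normal curve diagram, a sequence
of `n - 1` vertical arcs, the `i`-th of which lies between the punctures `k(i)` and `k(i)+1`;
that is, by the permutation `k = [k(1), …, k(n-1)]` of `1, …, n-1`. Codes and normal forms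
depend on the ordering through `k`. -/

/-- The list `k = [k(1), …, k(n-1)]` is a permutation of `1, …, n-1`. -/
def IsNormalDiagram (n : ℕ) (k : List ℕ) : Prop := k.Perm (List.range' 1 (n - 1))

/-- The Dehornoy ordering `<_D` of `B_n` is the normal ordering of the trivial permutation
`[1, 2, …, n-1]`. -/
def dehornoyDiagram (n : ℕ) : List ℕ := List.range' 1 (n - 1)

theorem isNormalDiagram_dehornoyDiagram (n : ℕ) : IsNormalDiagram n (dehornoyDiagram n) :=
  List.Perm.refl _

/-- The entry `k(i)`, for `1 ≤ i ≤ n - 1`. -/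
def diagramArc (k : List ℕ) (i : ℕ) : ℕ := k.getD (i - 1) 0

/-- `m_j = max {1, k(i)+1 | i ≤ j, k(i) < k(j+1)}`. -/
def lowerEnd (k : List ℕ) (j : ℕ) : ℕ :=
  (((k.take j).filter (fun a => a < diagramArc k (j + 1))).map (fun a => a + 1)).foldr max 1

/-- `M_j = min {n, k(i) | i ≤ j, k(i) > k(j+1)}`. -/
def upperEnd (n : ℕ) (k : List ℕ) (j : ℕ) : ℕ :=
  ((k.take j).filter (fun a => diagramArc k (j + 1) < a)).foldr min n

/-- The restriction of the ordering given by `k` to `⟨σ_lo, …, σ_{hi-1}⟩`, regarded as an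
ordering of `B_{hi-lo+1}` through the `(lo-1)`-fold shift: the arcs between the punctures
`lo, …, hi` are kept, in their order, and renumbered. -/
def restrictDiagram (k : List ℕ) (lo hi : ℕ) : List ℕ :=
  (k.filter (fun a => lo ≤ a ∧ a < hi)).map (fun a => a - (lo - 1))

/-! ### Codes -/

/-- Codes of positive braid words: for two strands a number, and for more strands the
left-infinite sequence `(…, 𝒞_1, 𝒞_0, 𝒞_{-1}, …, 𝒞_{-(n-2)})` of codes. The entries are numbered
from the right, so that `seq c` has `𝒞_i = c (i + (n-2))` for `i ≥ -(n-2)`. -/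
inductive BraidCode : Type
  | exp : ℕ → BraidCode
  | seq : (ℕ → BraidCode) → BraidCode

/-- The lexicographical ordering from the right, `<_right`. -/
inductive BraidCode.LtRight : BraidCode → BraidCode → Prop
  | exp {a b : ℕ} : a < b → LtRight (BraidCode.exp a) (BraidCode.exp b)
  | seq {c c' : ℕ → BraidCode} (l : ℕ) : (∀ i < l, c i = c' i) → LtRight (c l) (c' l) →
      LtRight (BraidCode.seq c) (BraidCode.seq c')

/-- `HasCode n k W C`: the positive `n`-braid word `W` has a tower of subword decompositions
whose code with respect to the normal ordering given by `k` is `C`. For `n ≥ 3` the word is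
decomposed as `W = A_m ⋯ A_1 A_0 A_{-1}` with `A_{-1} = X_1 X_2 ⋯ X_{n-2}`. Here `X_j` is a word
in `σ_{m_j}, …, σ_{M_j-1}` (so that `σ_{k(1)}` does not occur in `A_{-1}`), and
* `𝒞_i` (`i ≥ 1`) is a code of `D^{i-1}(A_i)` for the Dehornoy ordering of `B_{n-1}`;
* `𝒞_0` is a code of `Sh(A_0)` for the ordering restricted to `⟨σ_2, …, σ_{n-1}⟩`;
* `𝒞_{-j}` is a code of `Sh^{m_j-1}(X_j)` for the ordering restricted to
  `⟨σ_{m_j}, …, σ_{M_j-1}⟩`. -/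
inductive HasCode : ℕ → List ℕ → BraidWord → BraidCode → Prop
  | two (a : ℕ) : HasCode 2 [1] (List.replicate a 1) (BraidCode.exp a)
  | step (n : ℕ) (k : List ℕ) (hn : 3 ≤ n) (hk : IsNormalDiagram n k)
      (m : ℕ) (A X : ℕ → BraidWord) (c : ℕ → BraidCode)
      (hA : ∀ i, (A i).LettersIn (blockLetters n i))
      (hm : ∀ i, m < i → A i = [])
      (hX : ∀ j ∈ Set.Icc 1 (n - 2), (X j).LettersIn (Set.Ico (lowerEnd k j) (upperEnd n k j)))
      (hcA : ∀ i, 1 ≤ i →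
        HasCode (n - 1) (dehornoyDiagram (n - 1)) ((flipWord n)^[i - 1] (A i)) (c (n - 2 + i)))
      (hcA0 : HasCode (n - 1) (restrictDiagram k 2 n) (shiftWord 1 (A 0)) (c (n - 2)))
      (hcX : ∀ j ∈ Set.Icc 1 (n - 2),
        HasCode (upperEnd n k j - lowerEnd k j + 1)
          (restrictDiagram k (lowerEnd k j) (upperEnd n k j))
          (shiftWord (lowerEnd k j - 1) (X j)) (c (n - 2 - j))) :
      HasCode n k (concatBlocks A m ++ ((List.range' 1 (n - 2)).map X).flatten)
        (BraidCode.seq c)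

/-- `w` is a `𝒞`-normal form of `β` with respect to the normal ordering given by `k`: a positive
word representing `β` that has a tower whose code is the `<_right`-greatest one among all codes of
all positive words representing `β`. -/
def IsCNormalForm (n : ℕ) (k : List ℕ) (β : BraidGroup n) (w : BraidWord) : Prop :=
  ∃ c, IsPositiveRep n β w ∧ HasCode n k w c ∧
    ∀ w' c', IsPositiveRep n β w' → HasCode n k w' c' → c' = c ∨ BraidCode.LtRight c' c

/-! ### The `Φ`-normal form -/

/-- `δ` is the maximal right divisor `β ∧ B_S^+` of `β` in `B_S^+`. -/
def IsMaxRightDivisor (n : ℕ) (S : Set ℕ) (β δ : BraidGroup n) : Prop :=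
  δ ∈ parabolicMonoid n S ∧ β * δ⁻¹ ∈ positiveBraidMonoid n ∧
    ∀ δ' ∈ parabolicMonoid n S, β * δ'⁻¹ ∈ positiveBraidMonoid n →
      δ * δ'⁻¹ ∈ parabolicMonoid n S

/-- `β b_0⁻¹ b_1⁻¹ ⋯ b_{i-1}⁻¹`. -/
def remainder {n : ℕ} (β : BraidGroup n) (b : ℕ → BraidGroup n) : ℕ → BraidGroup n
  | 0 => β
  | i + 1 => remainder β b i * (b i)⁻¹

/-- `β = b_m ⋯ b_1 b_0` is the alternate decomposition of `β`. -/
def IsAlternateDecomposition (n : ℕ) (β : BraidGroup n) (m : ℕ) (b : ℕ → BraidGroup n) : Prop :=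
  (∀ i ≤ m, IsMaxRightDivisor n (blockLetters n i) (remainder β b i) (b i)) ∧
    remainder β b (m + 1) = 1

/-- The identification of words in the letters of the block `i` with positive `(n-1)`-braid words:
the shift for `i = 0`, the identity for odd `i`, the flip for even `i > 0`. -/
def blockToLower (n i : ℕ) (w : BraidWord) : BraidWord :=
  if i = 0 then shiftWord 1 w else if Odd i then w else flipWord n w

/-- `w` is the `Φ`-normal form (alternating normal form) of the positive `n`-braid `β`: for `n = 2`
it is the word `σ_1^a`; for `n ≥ 3` one takes the alternate decomposition `β = b_m ⋯ b_0` and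
concatenates words `w_m, …, w_0` representing `b_m, …, b_0` that are `Φ`-normal forms of
`(n-1)`-braids under the above identifications. -/
inductive IsPhiNormalForm : (n : ℕ) → BraidGroup n → BraidWord → Prop
  | two (a : ℕ) : IsPhiNormalForm 2 (braidGen 2 1 ^ a) (List.replicate a 1)
  | step (n : ℕ) (hn : 3 ≤ n) (β : BraidGroup n) (m : ℕ) (b : ℕ → BraidGroup n)
      (w : ℕ → BraidWord)
      (hb : IsAlternateDecomposition n β m b)
      (hw : ∀ i ≤ m, (w i).LettersIn (blockLetters n i) ∧ wordBraid n (w i) = b i)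
      (hrec : ∀ i ≤ m, IsPhiNormalForm (n - 1) (wordBraid (n - 1) (blockToLower n i (w i)))
        (blockToLower n i (w i))) :
      IsPhiNormalForm n β (concatBlocks w m)

/-! Both normal forms come out of one greedy procedure. Read the blocks of a word from the right:
X_{n-2}, …, X_1, A_0, A_1, …. Codes are compared at their rightmost difference, so the greatest code
takes for each block the maximal right divisor, in the allowed letters, of what is left, and writes
this divisor by the greatest code on fewer strands.

The induction on n works for a stronger claim (`IsGreatestForm`, `exists_isGreatestForm`): the code
is greatest among the codes of all words that represent right divisors of x. If a competitor agrees
with the greedy code to the right of block l, then its blocks there are the greedy ones, because a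
code determines its word (`HasCode.word_unique`). After cancelling them, its block l divides the
greedy remainder, hence the greedy block, and the induction hypothesis compares the two codes of
block l.

For the alternating form (`isPhiNormalForm_of_greedy`), X_1 and A_0 have the same letters, so the
greedy A_0 is empty, and X_1 ⋯ X_{n-2} is the first maximal right divisor; A_1, A_2, … are the
further ones. Each X_j has no nontrivial right divisor in the letters of X_{j+1}, so the block 0 of
its own alternating form is empty, and X_{j+1} ⋯ X_{n-2} can be put there
(`IsPhiNormalForm.append`). Uniqueness holds because maximal right divisors are unique.

Maximal divisors and right cancellation rest on `garside`, proved by induction on length. Central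
powers of the full twist give left cancellation and the Ore condition, so the Artin monoid embeds in
a group of fractions. As B_n maps to this group, positive words equal in B_n are equal in the monoid
(`wordBraid_eq_iff`), and the problem can be treated there. -/

/-! ### The Artin monoid of positive braids on infinitely many strands -/

/-- The braid relations between the generators `σ_0, σ_1, σ_2, …`. -/
inductive ArtinRel : FreeMonoid ℕ → FreeMonoid ℕ → Prop
  | comm (i j : ℕ) (h : i + 2 ≤ j) :
      ArtinRel (FreeMonoid.of i * FreeMonoid.of j) (FreeMonoid.of j * FreeMonoid.of i)
  | braid (i : ℕ) :
      ArtinRel (FreeMonoid.of i * FreeMonoid.of (i + 1) * FreeMonoid.of i)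
        (FreeMonoid.of (i + 1) * FreeMonoid.of i * FreeMonoid.of (i + 1))

/-- The monoid of positive braids with generators `σ_i`, `i ∈ ℕ`. -/
abbrev ArtinMonoid : Type := PresentedMonoid ArtinRel

namespace ArtinMonoid

/-- The generator `σ_i`. -/
def gen (i : ℕ) : ArtinMonoid := PresentedMonoid.of ArtinRel i

/-- Two generators that satisfy the braid relation of length three. -/
def Adj (i j : ℕ) : Prop := i + 1 = j ∨ j + 1 = i

/-- Two distinct generators that commute. -/
def Far (i j : ℕ) : Prop := i + 2 ≤ j ∨ j + 2 ≤ i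

theorem gen_comm {i j : ℕ} (h : Far i j) : gen i * gen j = gen j * gen i := by
  rcases h with h | h
  · exact PresentedMonoid.mk_eq_mk_of_rel (ArtinRel.comm i j h)
  · exact (PresentedMonoid.mk_eq_mk_of_rel (ArtinRel.comm j i h)).symm

theorem gen_braid {i j : ℕ} (h : Adj i j) : gen i * gen j * gen i = gen j * gen i * gen j := by
  rcases h with rfl | rfl
  · exact PresentedMonoid.mk_eq_mk_of_rel (ArtinRel.braid i)
  · exact (PresentedMonoid.mk_eq_mk_of_rel (ArtinRel.braid j)).symm

section Lift

variable {N : Type*} [Monoid N]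

/-- The homomorphism from the Artin monoid with prescribed values on the generators. -/
def lift (f : ℕ → N) (hc : ∀ i j, i + 2 ≤ j → f i * f j = f j * f i)
    (hb : ∀ i, f i * f (i + 1) * f i = f (i + 1) * f i * f (i + 1)) : ArtinMonoid →* N :=
  PresentedMonoid.lift f (by
    intro a b h
    cases h with
    | comm i j h => simpa using hc i j h
    | braid i => simpa using hb i)

theorem lift_gen (f : ℕ → N) (hc) (hb) (i : ℕ) : lift f hc hb (gen i) = f i := rfl

end Lift

/-- The positive braid represented by a word. -/
def ofWord (w : List ℕ) : ArtinMonoid := (w.map gen).prod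

@[simp] theorem ofWord_nil : ofWord [] = 1 := rfl

@[simp] theorem ofWord_cons (i : ℕ) (w : List ℕ) : ofWord (i :: w) = gen i * ofWord w := by
  simp [ofWord]

@[simp] theorem ofWord_append (u v : List ℕ) : ofWord (u ++ v) = ofWord u * ofWord v := by
  simp [ofWord]

theorem mk_eq_ofWord (w : FreeMonoid ℕ) :
    PresentedMonoid.mk ArtinRel w = ofWord (FreeMonoid.toList w) := by
  induction w using FreeMonoid.inductionOn' with
  | one => simp
  | of_mul i w ih => rw [map_mul, ih]; simp [gen, PresentedMonoid.of]

theorem exists_ofWord (x : ArtinMonoid) : ∃ w, ofWord w = x := by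
  obtain ⟨w, rfl⟩ := PresentedMonoid.surjective_mk x
  exact ⟨_, (mk_eq_ofWord w).symm⟩

/-- The length homomorphism. -/
def lenHom : ArtinMonoid →* Multiplicative ℕ :=
  lift (fun _ => Multiplicative.ofAdd 1) (fun _ _ _ => rfl) (fun _ => rfl)

/-- The length of a positive braid. -/
def len (x : ArtinMonoid) : ℕ := (lenHom x).toAdd

@[simp] theorem len_one : len 1 = 0 := by simp [len]

@[simp] theorem len_mul (x y : ArtinMonoid) : len (x * y) = len x + len y := by simp [len]

@[simp] theorem len_gen (i : ℕ) : len (gen i) = 1 := rfl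

@[simp] theorem len_ofWord (w : List ℕ) : len (ofWord w) = w.length := by
  induction w with
  | nil => simp
  | cons i w ih => simp [ih, add_comm]

theorem eq_one_of_len {x : ArtinMonoid} (h : len x = 0) : x = 1 := by
  obtain ⟨w, rfl⟩ := exists_ofWord x
  rw [len_ofWord, List.length_eq_zero_iff] at h
  simp [h]

theorem eq_one_or_mul_gen (x : ArtinMonoid) : x = 1 ∨ ∃ y i, x = y * gen i := by
  obtain ⟨w, rfl⟩ := exists_ofWord x
  rcases List.eq_nil_or_concat' w with rfl | ⟨v, i, rfl⟩
  · simp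
  · exact Or.inr ⟨ofWord v, i, by simp⟩

/-! ### Garside's lemma -/

open Classical in
/-- The complement: `compl i j * gen i` is the left common multiple of `gen i` and `gen j`. -/
noncomputable def compl (i j : ℕ) : ArtinMonoid :=
  if i = j then 1 else if Adj i j then gen i * gen j else gen j

theorem compl_self (i : ℕ) : compl i i = 1 := by simp [compl]

theorem compl_adj {i j : ℕ} (h : Adj i j) : compl i j = gen i * gen j := by
  have : i ≠ j := by rcases h with h | h <;> omega
  simp [compl, this, h]

theorem compl_far {i j : ℕ} (h : Far i j) : compl i j = gen j := by
  have h1 : i ≠ j := by rcases h with h | h <;> omega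
  have h2 : ¬ Adj i j := by rintro (h' | h') <;> rcases h with h | h <;> omega
  simp [compl, h1, h2]

theorem Adj.symm {i j : ℕ} (h : Adj i j) : Adj j i := Or.symm h

theorem Far.symm {i j : ℕ} (h : Far i j) : Far j i := Or.symm h

theorem eq_or_adj_or_far (i j : ℕ) : i = j ∨ Adj i j ∨ Far i j := by
  unfold Adj Far; omega

theorem compl_mul_gen (i j : ℕ) : compl i j * gen i = compl j i * gen j := by
  rcases eq_or_adj_or_far i j with rfl | h | h
  · rfl
  · rw [compl_adj h, compl_adj h.symm, gen_braid h]
  · rw [compl_far h, compl_far h.symm, gen_comm h]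

/-- Garside's property for elements `x, y` of length `< N`. -/
def GarsideBelow (N : ℕ) : Prop :=
  ∀ (i j : ℕ) (x y : ArtinMonoid), len x < N → x * gen i = y * gen j →
    ∃ z, x = z * compl i j ∧ y = z * compl j i

theorem GarsideBelow.cancel {N : ℕ} (H : GarsideBelow N) {i : ℕ} {x y : ArtinMonoid}
    (hx : len x < N) (h : x * gen i = y * gen i) : x = y := by
  obtain ⟨z, h1, h2⟩ := H i i x y hx h
  rw [h1, h2]

/-- This lemma and the next two are the cases of `GarsideBelow.middle` with distinct letters and `k`
adjacent to `i`. Applying `H` repeatedly to shorter elements exposes a common left factor of `p` and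
`q`; what remains is an identity between words in three generators. -/
theorem GarsideBelow.middle_adj_far_far {N : ℕ} (H : GarsideBelow N) {i j k : ℕ}
    {p q : ArtinMonoid} (hp : len (p * compl k i) ≤ N) (h : p * compl k i = q * compl k j)
    (hki : Adj k i) (hkj : Far k j) (hij : Far i j) :
    ∃ z, p * compl i k = z * compl i j ∧ q * compl j k = z * compl j i := by
  simp only [compl_adj hki, compl_adj hki.symm, compl_far hkj, compl_far hkj.symm, compl_far hij,
    compl_far hij.symm, len_mul, len_gen, ← mul_assoc] at hp h ⊢
  obtain ⟨z, h1, rfl⟩ := H i j _ _ (by simp; omega) h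
  rw [compl_far hij] at h1
  obtain ⟨s, rfl, rfl⟩ := H k j _ _ (by omega) h1
  rw [compl_far hkj, compl_far hkj.symm, compl_far hij.symm]
  refine ⟨s * gen i * gen k, ?_, ?_⟩
  · simp only [mul_assoc]
    rw [gen_comm hkj, ← mul_assoc (gen i), gen_comm hij, mul_assoc]
  · have := gen_braid hki
    simp only [mul_assoc] at this ⊢
    rw [this]

theorem GarsideBelow.middle_adj_adj_far {N : ℕ} (H : GarsideBelow N) {i j k : ℕ}
    {p q : ArtinMonoid} (hp : len (p * compl k i) ≤ N) (h : p * compl k i = q * compl k j)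
    (hki : Adj k i) (hkj : Adj k j) (hij : Far i j) :
    ∃ z, p * compl i k = z * compl i j ∧ q * compl j k = z * compl j i := by
  have hl := congrArg len h
  simp only [compl_adj hki, compl_adj hki.symm, compl_adj hkj, compl_adj hkj.symm, compl_far hij,
    compl_far hij.symm, len_mul, len_gen, ← mul_assoc] at hp h hl ⊢
  obtain ⟨z, h1, h2⟩ := H i j _ _ (by simp; omega) h
  rw [compl_far hij] at h1
  rw [compl_far hij.symm] at h2
  obtain ⟨s, rfl, h3⟩ := H k j _ _ (by omega) h1
  obtain ⟨t, rfl, h4⟩ := H k i _ _ (by omega) h2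
  rw [compl_adj hkj] at hp
  simp only [compl_adj hki, compl_adj hki.symm, compl_adj hkj, compl_adj hkj.symm, len_mul,
    len_gen, ← mul_assoc] at *
  have h5 := H.cancel (by simp; omega) (h3.symm.trans h4)
  obtain ⟨u, rfl, rfl⟩ := H j i _ _ (by omega) h5
  rw [compl_far hij, compl_far hij.symm]
  have hab := gen_comm hij
  have hca := gen_braid hki
  have hcb := gen_braid hkj
  generalize gen i = a at *
  generalize gen j = b at *
  generalize gen k = c at *
  refine ⟨u * c * a * b * c, ?_, ?_⟩
  · calc u * a * c * b * a * c = u * a * c * (b * a) * c := by simp only [mul_assoc]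
      _ = u * (a * c * a) * (b * c) := by rw [← hab]; simp only [mul_assoc]
      _ = u * c * a * (c * b * c) := by rw [← hca]; simp only [mul_assoc]
      _ = _ := by rw [hcb]; simp only [mul_assoc]
  · calc u * b * c * a * b * c = u * b * c * (a * b) * c := by simp only [mul_assoc]
      _ = u * (b * c * b) * (a * c) := by rw [hab]; simp only [mul_assoc]
      _ = u * c * b * (c * a * c) := by rw [← hcb]; simp only [mul_assoc]
      _ = u * c * (b * a) * c * a := by rw [hca]; simp only [mul_assoc]
      _ = _ := by rw [← hab]; simp only [mul_assoc]

theorem GarsideBelow.middle_adj_far_adj {N : ℕ} (H : GarsideBelow N) {i j k : ℕ}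
    {p q : ArtinMonoid} (hp : len (p * compl k i) ≤ N) (h : p * compl k i = q * compl k j)
    (hki : Adj k i) (hkj : Far k j) (hij : Adj i j) :
    ∃ z, p * compl i k = z * compl i j ∧ q * compl j k = z * compl j i := by
  have hl := congrArg len h
  simp only [compl_adj hki, compl_adj hki.symm, compl_far hkj, compl_far hkj.symm, compl_adj hij,
    compl_adj hij.symm, len_mul, len_gen, ← mul_assoc] at hp h hl ⊢
  obtain ⟨z, h1, rfl⟩ := H i j _ _ (by simp; omega) h
  rw [compl_adj hij, ← mul_assoc] at h1
  obtain ⟨s, rfl, h3⟩ := H k j _ _ (by omega) h1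
  rw [compl_far hkj.symm] at h3
  rw [compl_far hkj] at h1
  have hl3 := congrArg len h3
  simp only [compl_far hkj, compl_adj hij.symm, len_mul, len_gen] at *
  obtain ⟨t, rfl, rfl⟩ := H i k _ _ (by omega) h3
  have hcb := gen_comm hkj
  have hca := gen_braid hki
  have hab := gen_braid hij
  rw [compl_adj hki, compl_adj hki.symm]
  generalize gen i = a at *
  generalize gen j = b at *
  generalize gen k = c at *
  refine ⟨t * b * a * c, ?_, ?_⟩
  · calc t * (c * a) * b * a * c = t * c * (a * b * a) * c := by simp only [mul_assoc]
      _ = t * (c * b) * a * (b * c) := by rw [hab]; simp only [mul_assoc]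
      _ = t * (b * c) * a * (c * b) := by rw [hcb]
      _ = t * b * (c * a * c) * b := by simp only [mul_assoc]
      _ = _ := by rw [hca]; simp only [mul_assoc]
  · calc t * (a * c) * (b * a) * c = t * a * (c * b) * a * c := by simp only [mul_assoc]
      _ = t * a * b * (c * a * c) := by rw [hcb]; simp only [mul_assoc]
      _ = t * (a * b * a) * c * a := by rw [hca]; simp only [mul_assoc]
      _ = t * b * a * (b * c) * a := by rw [hab]; simp only [mul_assoc]
      _ = _ := by rw [← hcb]; simp only [mul_assoc]

/-- The two factorizations through a middle letter `k` can be combined. -/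
theorem GarsideBelow.middle {N : ℕ} (H : GarsideBelow N) (i j k : ℕ) (p q : ArtinMonoid)
    (hp : len (p * compl k i) ≤ N) (h : p * compl k i = q * compl k j) :
    ∃ z, p * compl i k = z * compl i j ∧ q * compl j k = z * compl j i := by
  have hq : len (q * compl k j) ≤ N := h ▸ hp
  rcases eq_or_ne k i with rfl | hki'
  · exact ⟨q, by simpa [compl_self] using h, rfl⟩
  rcases eq_or_ne k j with rfl | hkj'
  · exact ⟨p, rfl, by simpa [compl_self] using h.symm⟩
  rcases eq_or_ne i j with rfl | hij'
  · suffices p = q by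
      subst this
      exact ⟨p * compl i k, by simp [compl_self], by simp [compl_self]⟩
    rcases eq_or_adj_or_far k i with h1 | h1 | h1
    · exact absurd h1 hki'
    · simp only [compl_adj h1, ← mul_assoc, len_mul, len_gen] at h hp
      exact H.cancel (by omega) (H.cancel (by simp; omega) h)
    · simp only [compl_far h1, len_mul, len_gen] at h hp
      exact H.cancel (by omega) h
  have swap : (∃ z, q * compl j k = z * compl j i ∧ p * compl i k = z * compl i j) →
      ∃ z, p * compl i k = z * compl i j ∧ q * compl j k = z * compl j i :=
    fun ⟨z, h1, h2⟩ => ⟨z, h2, h1⟩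
  rcases (eq_or_adj_or_far k i).resolve_left hki' with hki | hki <;>
  rcases (eq_or_adj_or_far k j).resolve_left hkj' with hkj | hkj <;>
  rcases (eq_or_adj_or_far i j).resolve_left hij' with hij | hij
  -- The Coxeter graph is a path, so three letters cannot be pairwise adjacent.
  · exfalso; unfold Adj at *; omega
  · exact H.middle_adj_adj_far hp h hki hkj hij
  · exact H.middle_adj_far_adj hp h hki hkj hij
  · exact H.middle_adj_far_far hp h hki hkj hij
  · exact swap (H.middle_adj_far_adj hq h.symm hkj hki hij.symm)
  · exact swap (H.middle_adj_far_far hq h.symm hkj hki hij.symm)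
  · simp only [compl_far hki, compl_far hki.symm, compl_far hkj, compl_far hkj.symm, len_mul,
      len_gen] at hp h ⊢
    obtain ⟨z, rfl, rfl⟩ := H i j _ _ (by omega) h
    refine ⟨z * gen k, ?_, ?_⟩
    · simp only [compl_adj hij, mul_assoc]
      rw [← gen_comm hkj, ← mul_assoc (gen i), ← gen_comm hki, mul_assoc]
    · simp only [compl_adj hij.symm, mul_assoc]
      rw [← gen_comm hki, ← mul_assoc (gen j), ← gen_comm hkj, mul_assoc]
  · simp only [compl_far hki, compl_far hki.symm, compl_far hkj, compl_far hkj.symm, len_mul,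
      len_gen] at hp h ⊢
    obtain ⟨z, rfl, rfl⟩ := H i j _ _ (by omega) h
    refine ⟨z * gen k, ?_, ?_⟩
    · simp only [compl_far hij, mul_assoc]
      rw [gen_comm hkj]
    · simp only [compl_far hij.symm, mul_assoc]
      rw [gen_comm hki]

/-- Induction on the derivation of the congruence. A defining relation is itself an instance with `z
= 1`; the step that needs `H` is transitivity. -/
theorem GarsideBelow.of_rel {N : ℕ} (H : GarsideBelow N) {u v : FreeMonoid ℕ}
    (h : ConGen.Rel ArtinRel u v) (hu : len (PresentedMonoid.mk ArtinRel u) ≤ N + 1)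
    (i j : ℕ) (x y : FreeMonoid ℕ) (hx : u = x * FreeMonoid.of i) (hy : v = y * FreeMonoid.of j) :
    ∃ z, PresentedMonoid.mk ArtinRel x = z * compl i j ∧
      PresentedMonoid.mk ArtinRel y = z * compl j i := by
  have split : ∀ w : FreeMonoid ℕ, w = 1 ∨ ∃ t k, w = t * FreeMonoid.of k :=
    fun w => List.eq_nil_or_concat' w
  have inj : ∀ {s t : FreeMonoid ℕ} {a b : ℕ},
      s * FreeMonoid.of a = t * FreeMonoid.of b → s = t ∧ a = b := fun h =>
    ⟨List.append_inj_left' h rfl, by simpa using List.append_inj_right' h rfl⟩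
  have lenof : ∀ {s t : FreeMonoid ℕ}, ConGen.Rel ArtinRel s t →
      PresentedMonoid.mk ArtinRel s = PresentedMonoid.mk ArtinRel t := fun h =>
    PresentedMonoid.mk_eq_mk_iff.2 h
  induction h generalizing i j x y with
  | of u v h =>
    cases h with
    | comm a b h =>
      obtain ⟨rfl, rfl⟩ := inj hx
      obtain ⟨rfl, rfl⟩ := inj hy
      refine ⟨1, ?_, ?_⟩
      · rw [compl_far (Or.inr h), one_mul]; rfl
      · rw [compl_far (Or.inl h), one_mul]; rfl
    | braid a =>
      obtain ⟨rfl, rfl⟩ := inj hx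
      obtain ⟨rfl, rfl⟩ := inj hy
      refine ⟨1, ?_, ?_⟩
      · rw [compl_adj (Or.inl rfl), one_mul]; rfl
      · rw [compl_adj (Or.inr rfl), one_mul]; rfl
  | refl u =>
    obtain ⟨rfl, rfl⟩ := inj (hx.symm.trans hy)
    exact ⟨_, by rw [compl_self, mul_one], by rw [compl_self, mul_one]⟩
  | symm h ih =>
    obtain ⟨z, h1, h2⟩ := ih (by rwa [lenof h]) j i y x hy hx
    exact ⟨z, h2, h1⟩
  -- The intermediate word is nonempty because relations preserve length. Its last letter `k` gives
  -- two factorizations of the same element, which `GarsideBelow.middle` merges.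
  | @trans u w v h1 h2 ih1 ih2 =>
    have hl := congrArg len (lenof h1)
    rcases split w with rfl | ⟨t, k, rfl⟩
    · subst hx
      rw [map_mul, len_mul, map_one, len_one] at hl
      have : len (PresentedMonoid.mk ArtinRel (FreeMonoid.of i)) = 1 := len_gen i
      omega
    · obtain ⟨p, e1, e2⟩ := ih1 hu i k x t hx rfl
      obtain ⟨q, e3, e4⟩ := ih2 (by omega) k j t y rfl hy
      have hk : len (PresentedMonoid.mk ArtinRel (FreeMonoid.of k)) = 1 := len_gen k
      rw [map_mul, len_mul, hk] at hl
      obtain ⟨z, f1, f2⟩ := H.middle i j k p q (by rw [← e2]; omega) (e2.symm.trans e3)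
      exact ⟨z, e1.trans f1, e4.trans f2⟩
  | @mul u1 v1 u2 v2 h1 h2 ih1 ih2 =>
    rw [map_mul, len_mul] at hu
    have hl1 := congrArg len (lenof h1)
    have hl2 := congrArg len (lenof h2)
    have hone : ∀ (t : FreeMonoid ℕ) (k : ℕ),
        len (PresentedMonoid.mk ArtinRel (t * FreeMonoid.of k)) =
          len (PresentedMonoid.mk ArtinRel t) + 1 := fun t k => by
      rw [map_mul, len_mul]; exact congrArg _ (len_gen k)
    have hzero : len (PresentedMonoid.mk ArtinRel 1) = 0 := by rw [map_one, len_one]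
    rcases split u2 with rfl | ⟨x2, a, rfl⟩ <;> rcases split v2 with rfl | ⟨y2, b, rfl⟩
    · rw [mul_one] at hx hy
      exact ih1 (by omega) i j x y hx hy
    · rw [hone, hzero] at hl2; omega
    · rw [hone, hzero] at hl2; omega
    · rw [← mul_assoc] at hx hy
      obtain ⟨rfl, rfl⟩ := inj hx
      obtain ⟨rfl, rfl⟩ := inj hy
      obtain ⟨z, e1, e2⟩ := ih2 (by omega) _ _ _ _ rfl rfl
      refine ⟨PresentedMonoid.mk ArtinRel u1 * z, ?_, ?_⟩
      · rw [map_mul, e1, mul_assoc]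
      · rw [map_mul, e2, lenof h1, mul_assoc]

theorem garsideBelow (N : ℕ) : GarsideBelow N := by
  induction N with
  | zero => intro i j x y hx; omega
  | succ N H =>
    intro i j x y hx h
    obtain ⟨u, rfl⟩ := PresentedMonoid.surjective_mk x
    obtain ⟨v, rfl⟩ := PresentedMonoid.surjective_mk y
    have h' : PresentedMonoid.mk ArtinRel (u * FreeMonoid.of i) =
        PresentedMonoid.mk ArtinRel (v * FreeMonoid.of j) := h
    refine H.of_rel (PresentedMonoid.mk_eq_mk_iff.1 h') ?_ i j u v rfl rfl
    have : len (PresentedMonoid.mk ArtinRel (FreeMonoid.of i)) = 1 := len_gen i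
    rw [map_mul, len_mul, this]
    omega

/-- **Garside's lemma**: a common left multiple of two generators is a left multiple of their
least common left multiple. -/
theorem garside {i j : ℕ} {x y : ArtinMonoid} (h : x * gen i = y * gen j) :
    ∃ z, x = z * compl i j ∧ y = z * compl j i :=
  garsideBelow (len x + 1) i j x y (by omega) h

theorem mul_right_cancel_gen {i : ℕ} {x y : ArtinMonoid} (h : x * gen i = y * gen i) : x = y := by
  obtain ⟨z, h1, h2⟩ := garside h
  rw [h1, h2]

instance : IsRightCancelMul ArtinMonoid where
  mul_right_cancel a x y h := by
    obtain ⟨w, rfl⟩ := exists_ofWord a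
    induction w using List.reverseRecOn with
    | nil => simpa using h
    | append_singleton w i ih =>
      simp only [ofWord_append, ofWord_cons, ofWord_nil, mul_one, ← mul_assoc] at h
      exact ih (mul_right_cancel_gen h)

/-! ### Supports and relabellings -/

open Classical in
/-- The homomorphism that detects whether all letters lie in `S`. -/
noncomputable def supportHom (S : Set ℕ) : ArtinMonoid →* ℕ :=
  lift (fun i => if i ∈ S then 1 else 0) (fun _ _ _ => mul_comm _ _)
    (fun _ => by split_ifs <;> simp)

/-- The positive braid `x` is a product of generators in `S`. -/
def On (S : Set ℕ) (x : ArtinMonoid) : Prop := supportHom S x = 1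

@[simp] theorem on_one (S : Set ℕ) : On S 1 := map_one _

@[simp] theorem on_mul {S : Set ℕ} {x y : ArtinMonoid} : On S (x * y) ↔ On S x ∧ On S y := by
  simp [On]

@[simp] theorem on_gen {S : Set ℕ} {i : ℕ} : On S (gen i) ↔ i ∈ S := by
  simp only [On, supportHom, lift_gen]
  split_ifs with h <;> simp [h]

theorem on_ofWord {S : Set ℕ} {w : BraidWord} : On S (ofWord w) ↔ w.LettersIn S := by
  induction w with
  | nil => simp [BraidWord.LettersIn]
  | cons i w ih => simp [BraidWord.LettersIn] at ih ⊢; simp [ih]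

theorem On.mono {S T : Set ℕ} (h : S ⊆ T) {x : ArtinMonoid} (hx : On S x) : On T x := by
  obtain ⟨w, rfl⟩ := exists_ofWord x
  rw [on_ofWord] at *
  exact fun l hl => h (hx l hl)

theorem on_compl {S : Set ℕ} {i j : ℕ} (hi : i ∈ S) (hj : j ∈ S) : On S (compl i j) := by
  unfold compl
  split_ifs <;> simp [hi, hj]

/-- A map of letters that preserves the braid relations on `S`. -/
def IsRelabelling (f : ℕ → ℕ) (S : Set ℕ) : Prop :=
  ∀ i ∈ S, ∀ j ∈ S, (Adj i j → Adj (f i) (f j)) ∧ (Far i j → Far (f i) (f j))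

/-- The relabelling respects relations only between letters of `S`. Sending all other letters to an
adjoined zero makes it a homomorphism on the whole monoid, since both sides of a relation have the
same letters. -/
theorem ofWord_map {f : ℕ → ℕ} {S : Set ℕ} (hf : IsRelabelling f S) {u v : BraidWord}
    (hu : u.LettersIn S) (h : ofWord u = ofWord v) : ofWord (u.map f) = ofWord (v.map f) := by
  classical
  have hv : v.LettersIn S := by rwa [← on_ofWord, ← h, on_ofWord]
  let φ : ArtinMonoid →* WithZero ArtinMonoid :=
    lift (fun i => if i ∈ S then (gen (f i) : WithZero ArtinMonoid) else 0)
      (fun i j h => by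
        split_ifs with hi hj
        · rw [← WithZero.coe_mul, ← WithZero.coe_mul, gen_comm ((hf i hi j hj).2 (Or.inl h))]
        all_goals simp)
      (fun i => by
        split_ifs with hi hj
        · simp only [← WithZero.coe_mul, gen_braid ((hf i hi _ hj).1 (Or.inl rfl))]
        all_goals simp)
  have key : ∀ w : BraidWord, w.LettersIn S → φ (ofWord w) = (ofWord (w.map f) : ArtinMonoid) := by
    intro w hw
    induction w with
    | nil => simp
    | cons i w ih =>
      have hi : i ∈ S := hw i (by simp)
      have : φ (gen i) = (gen (f i) : WithZero ArtinMonoid) := by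
        simp [φ, lift_gen, hi]
      rw [ofWord_cons, map_mul, ih (fun l hl => hw l (by simp [hl])), this, List.map_cons,
        ofWord_cons, WithZero.coe_mul]
  have := congrArg φ h
  rwa [key u hu, key v hv, WithZero.coe_inj] at this

/-! ### Maximal right divisors -/

/-- `d` divides `x` on the right. -/
def RDvd (d x : ArtinMonoid) : Prop := ∃ y, x = y * d

theorem RDvd.refl (x : ArtinMonoid) : RDvd x x := ⟨1, by simp⟩

theorem RDvd.trans {x y z : ArtinMonoid} : RDvd x y → RDvd y z → RDvd x z := by
  rintro ⟨a, rfl⟩ ⟨b, rfl⟩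
  exact ⟨b * a, by rw [mul_assoc]⟩

theorem RDvd.mul_right {x y : ArtinMonoid} (z : ArtinMonoid) : RDvd x y → RDvd (x * z) (y * z) := by
  rintro ⟨a, rfl⟩
  exact ⟨a, by rw [mul_assoc]⟩

theorem RDvd.of_mul_right {x y z : ArtinMonoid} : RDvd (x * z) (y * z) → RDvd x y := by
  rintro ⟨a, h⟩
  exact ⟨a, mul_right_cancel (h.trans (mul_assoc a x z).symm)⟩

theorem rdvd_mul_left (x y : ArtinMonoid) : RDvd x (y * x) := ⟨y, rfl⟩

theorem one_rdvd (x : ArtinMonoid) : RDvd 1 x := ⟨x, by simp⟩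

/-- Two right divisors with letters in `S` have a common left multiple with the same
properties. -/
theorem exists_common_multiple (S : Set ℕ) (x d e : ArtinMonoid) (hd : On S d) (he : On S e)
    (hdx : RDvd d x) (hex : RDvd e x) : ∃ m, On S m ∧ RDvd m x ∧ RDvd d m ∧ RDvd e m := by
  induction hn : len x using Nat.strong_induction_on generalizing x d e with
  | _ n ih =>
  rcases eq_one_or_mul_gen d with rfl | ⟨d', i, rfl⟩
  · exact ⟨e, he, hex, one_rdvd e, RDvd.refl e⟩
  rcases eq_one_or_mul_gen e with rfl | ⟨e', j, rfl⟩
  · exact ⟨_, hd, hdx, RDvd.refl _, one_rdvd _⟩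
  rw [on_mul, on_gen] at hd he
  obtain ⟨y, rfl⟩ := hdx
  obtain ⟨y', h⟩ := hex
  rw [← mul_assoc, ← mul_assoc] at h
  obtain ⟨z, h1, h2⟩ := garside h
  simp only [len_mul, len_gen] at hn
  have hl := congrArg len h
  simp only [len_mul, len_gen] at hl
  -- Both `d'` and `compl i j` divide the shorter element `y * d'`. With their common multiple
  -- written as `c * compl i j`, the identity `compl_mul_gen` turns its product with `gen i` into
  -- one ending in `gen j`, so the second use of the hypothesis takes place in `y' * e'`.
  obtain ⟨m, hm, hmy, hdm, hcm⟩ := ih (len (y * d')) (by rw [len_mul]; omega) (y * d') d'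
    (compl i j) hd.1 (on_compl hd.2 he.2) (rdvd_mul_left _ _) ⟨z, h1⟩ rfl
  obtain ⟨c, rfl⟩ := hcm
  have hy' : RDvd (c * compl j i) (y' * e') := by
    apply RDvd.of_mul_right (z := gen j)
    rw [← h, mul_assoc, ← compl_mul_gen, ← mul_assoc]
    exact hmy.mul_right _
  rw [on_mul] at hm
  obtain ⟨m', hm', hmy', hem', hcm'⟩ := ih (len (y' * e')) (by rw [len_mul]; omega) (y' * e') e'
    (c * compl j i) he.1 (on_mul.2 ⟨hm.1, on_compl he.2 hd.2⟩) (rdvd_mul_left _ _) hy' rfl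
  refine ⟨m' * gen j, by simp [hm', he.2], ?_, ?_, hem'.mul_right _⟩
  · rw [← mul_assoc, h]
    exact hmy'.mul_right _
  · refine (hdm.mul_right (gen i)).trans ?_
    rw [mul_assoc, compl_mul_gen, ← mul_assoc]
    exact hcm'.mul_right _

/-- `d` is the maximal right divisor of `x` with letters in `S`. -/
structure IsMaxDiv (S : Set ℕ) (x d : ArtinMonoid) : Prop where
  on : On S d
  rdvd : RDvd d x
  max : ∀ e, On S e → RDvd e x → RDvd e d

/-- A longest right divisor in `S` works: its common multiple with any other one is again such a
divisor, hence no longer, hence equal to it. -/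
theorem exists_isMaxDiv (S : Set ℕ) (x : ArtinMonoid) : ∃ d, IsMaxDiv S x d := by
  classical
  let P : ℕ → Prop := fun k => ∃ d, On S d ∧ RDvd d x ∧ len d = k
  have hP0 : P 0 := ⟨1, on_one S, one_rdvd x, len_one⟩
  obtain ⟨d, hd, hdx, hk⟩ := Nat.findGreatest_spec (P := P) (Nat.zero_le (len x)) hP0
  refine ⟨d, hd, hdx, fun e he hex => ?_⟩
  obtain ⟨m, hm, hmx, ⟨a, ha⟩, hem⟩ := exists_common_multiple S x d e hd he hdx hex
  have hmle : len m ≤ len x := by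
    obtain ⟨b, rfl⟩ := hmx
    simp
  have h1 : len m ≤ len d := hk ▸ Nat.le_findGreatest hmle ⟨m, hm, hmx, rfl⟩
  have h2 : len m = len a + len d := by rw [ha, len_mul]
  have h3 : a = 1 := eq_one_of_len (by omega)
  rw [h3, one_mul] at ha
  rwa [← ha]

theorem eq_one_of_mul_eq_one {a b : ArtinMonoid} (h : a * b = 1) : a = 1 ∧ b = 1 := by
  have := congrArg len h
  rw [len_mul, len_one] at this
  exact ⟨eq_one_of_len (by omega), eq_one_of_len (by omega)⟩

/-- If `p` has no right divisor in `S`, then `q` is the maximal right divisor of `p * q`. -/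
theorem isMaxDiv_mul {S : Set ℕ} {p q : ArtinMonoid} (hq : On S q)
    (hp : ∀ d, On S d → RDvd d p → d = 1) : IsMaxDiv S (p * q) q := by
  obtain ⟨d, hd⟩ := exists_isMaxDiv S (p * q)
  obtain ⟨a, rfl⟩ := hd.max q hq (rdvd_mul_left _ _)
  have ha : a = 1 := hp a (on_mul.1 hd.on).1 (RDvd.of_mul_right hd.rdvd)
  rwa [ha, one_mul] at hd

/-- What remains after division by the maximal right divisor has no right divisor in `S`. -/
theorem IsMaxDiv.rest {S : Set ℕ} {y d : ArtinMonoid} (h : IsMaxDiv S (y * d) d) :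
    ∀ e, On S e → RDvd e y → e = 1 := by
  intro e he hey
  obtain ⟨a, ha⟩ := h.max (e * d) (on_mul.2 ⟨he, h.on⟩) (hey.mul_right d)
  rw [← mul_assoc] at ha
  exact (eq_one_of_mul_eq_one (mul_right_cancel ((one_mul d).trans ha)).symm).2

/-- Multiplication by an element with letters in `S` on the right. -/
theorem IsMaxDiv.mul {S : Set ℕ} {y d e : ArtinMonoid} (hd : On S d) (he : IsMaxDiv S y e) :
    IsMaxDiv S (y * d) (e * d) := by
  obtain ⟨z, rfl⟩ := he.rdvd
  rw [mul_assoc]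
  exact isMaxDiv_mul (on_mul.2 ⟨he.on, hd⟩) he.rest

/-! ### Common multiples and the embedding into a group -/

theorem gen_mul_ofWord_comm {i : ℕ} {w : BraidWord} (h : ∀ l ∈ w, Far i l) :
    gen i * ofWord w = ofWord w * gen i := by
  induction w with
  | nil => simp
  | cons l w ih =>
    rw [ofWord_cons, ← mul_assoc, gen_comm (h l (by simp)), mul_assoc, mul_assoc,
      ih (fun k hk => h k (by simp [hk]))]

/-! ### The full twist as a central element -/

/-- The braid `σ_0 σ_1 ⋯ σ_{m-1}`. -/
def cycle (m : ℕ) : ArtinMonoid := ofWord (List.range m)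

theorem cycle_succ (m : ℕ) : cycle (m + 1) = cycle m * gen m := by
  simp [cycle, List.range_succ]

theorem gen_mul_cycle_comm {m i : ℕ} (h : m < i) : gen i * cycle m = cycle m * gen i :=
  gen_mul_ofWord_comm fun l hl => Or.inr (by rw [List.mem_range] at hl; omega)

theorem gen_succ_mul_cycle {m i : ℕ} (h : i + 1 < m) :
    gen (i + 1) * cycle m = cycle m * gen i := by
  induction m with
  | zero => omega
  | succ m ih =>
    rcases Nat.lt_succ_iff_lt_or_eq.1 h with h' | rfl
    · rw [cycle_succ, ← mul_assoc, ih h', mul_assoc, mul_assoc, gen_comm (Or.inl h')]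
    · rw [cycle_succ, cycle_succ, ← mul_assoc, ← mul_assoc, gen_mul_cycle_comm (Nat.lt_succ_self i)]
      simp only [mul_assoc]
      rw [← mul_assoc (gen i), gen_braid (Or.inl rfl), mul_assoc]

/-- Passing one cycle lowers an index by one, which is no help at index 0. Two cycles bring `gen 0`
to the last generator: the first cycle turns the initial part of the second into its shift, and `gen
0` followed by this shift is a cycle again. -/
theorem gen_zero_mul_cycle_sq (m : ℕ) :
    gen 0 * (cycle (m + 1) * cycle (m + 1)) = cycle (m + 1) * cycle (m + 1) * gen m := by
  have h1 : ∀ k ≤ m, cycle (m + 1) * ofWord (List.range k) =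
      ofWord ((List.range k).map (· + 1)) * cycle (m + 1) := by
    intro k hk
    induction k with
    | zero => simp
    | succ k ih =>
      rw [List.range_succ, ofWord_append, ← mul_assoc, ih (by omega), List.map_append, ofWord_append,
        mul_assoc, mul_assoc]
      simp [gen_succ_mul_cycle (show k + 1 < m + 1 by omega)]
  have h2 : cycle (m + 1) = gen 0 * ofWord ((List.range m).map (· + 1)) := by
    rw [cycle, List.range_succ_eq_map]
    simp
  calc gen 0 * (cycle (m + 1) * cycle (m + 1))
      = gen 0 * (cycle (m + 1) * ofWord (List.range m) * gen m) := by
        nth_rw 2 [cycle_succ]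
        simp only [mul_assoc, cycle]
    _ = gen 0 * ofWord ((List.range m).map (· + 1)) * cycle (m + 1) * gen m := by
        rw [h1 m le_rfl]
        simp only [mul_assoc]
    _ = _ := by rw [← h2]

theorem gen_add_mul_cycle_pow {m i k : ℕ} (h : i + k < m) :
    gen (i + k) * cycle m ^ k = cycle m ^ k * gen i := by
  induction k with
  | zero => simp
  | succ k ih =>
    rw [pow_succ', ← mul_assoc, ← add_assoc, gen_succ_mul_cycle (by omega), mul_assoc,
      ih (by omega), mul_assoc]

/-- The full twist, which is central in the submonoid generated by `σ_0, …, σ_{m-1}`. -/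
def fullTwist (m : ℕ) : ArtinMonoid := cycle m ^ (m + 1)

theorem gen_mul_fullTwist {m i : ℕ} (h : i < m) : gen i * fullTwist m = fullTwist m * gen i := by
  obtain ⟨k, rfl⟩ : ∃ k, m = i + k + 1 := ⟨m - i - 1, by omega⟩
  -- The `m + 1` cycles split as `i`, `2` and `k`: the index goes down from `i` to 0, wraps around
  -- to `m - 1 = i + k`, and goes down to `i` again.
  have e : fullTwist (i + k + 1) = cycle (i + k + 1) ^ i *
      (cycle (i + k + 1) * cycle (i + k + 1)) * cycle (i + k + 1) ^ k := by
    rw [fullTwist, ← pow_two, ← pow_add, ← pow_add]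
    congr 1
    omega
  have h1 := gen_add_mul_cycle_pow (m := i + k + 1) (i := 0) (k := i) (by omega)
  rw [zero_add] at h1
  have h2 := gen_add_mul_cycle_pow (m := i + k + 1) (i := i) (k := k) (by omega)
  rw [e, ← mul_assoc, ← mul_assoc, h1, mul_assoc _ (gen 0), gen_zero_mul_cycle_sq]
  simp only [mul_assoc]
  rw [h2]

theorem mul_fullTwist {m : ℕ} {x : ArtinMonoid} (hx : On (Set.Iio m) x) :
    x * fullTwist m = fullTwist m * x := by
  obtain ⟨w, rfl⟩ := exists_ofWord x
  rw [on_ofWord] at hx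
  induction w with
  | nil => simp
  | cons i w ih =>
    rw [ofWord_cons, mul_assoc, ih (fun l hl => hx l (by simp [hl])), ← mul_assoc,
      gen_mul_fullTwist (hx i (by simp)), mul_assoc]

theorem gen_rdvd_fullTwist {m i : ℕ} (h : i < m) : RDvd (gen i) (fullTwist m) := by
  obtain ⟨k, rfl⟩ : ∃ k, m = i + k + 1 := ⟨m - i - 1, by omega⟩
  -- The last letter `gen (i + k)` of one cycle is moved through the `k` cycles to its right and
  -- becomes `gen i`.
  refine ⟨cycle (i + k + 1) ^ (i + 1) * cycle (i + k) * cycle (i + k + 1) ^ k, ?_⟩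
  rw [mul_assoc, ← gen_add_mul_cycle_pow (by omega), mul_assoc, ← mul_assoc (cycle (i + k)),
    ← cycle_succ, ← pow_succ', ← pow_add, fullTwist]
  congr 1
  omega

theorem exists_rdvd_fullTwist_pow {m : ℕ} {x : ArtinMonoid} (hx : On (Set.Iio m) x) :
    ∃ k, RDvd x (fullTwist m ^ k) := by
  obtain ⟨w, rfl⟩ := exists_ofWord x
  induction w with
  | nil => exact ⟨0, one_rdvd _⟩
  | cons i w ih =>
    rw [ofWord_cons, on_mul, on_gen] at hx
    obtain ⟨k, y, hy⟩ := ih hx.2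
    obtain ⟨z, hz⟩ := gen_rdvd_fullTwist hx.1
    refine ⟨k + 1, y * z, ?_⟩
    rw [pow_succ, hy, mul_assoc, mul_fullTwist hx.2, hz, ofWord_cons]
    simp only [mul_assoc]

theorem exists_on_Iio (x : ArtinMonoid) : ∃ m, On (Set.Iio m) x := by
  obtain ⟨w, rfl⟩ := exists_ofWord x
  induction w with
  | nil => exact ⟨0, on_one _⟩
  | cons i w ih =>
    obtain ⟨m, hm⟩ := ih
    refine ⟨max (i + 1) m, ?_⟩
    rw [ofWord_cons, on_mul, on_gen]
    exact ⟨by simp, hm.mono (Set.Iio_subset_Iio (le_max_right _ _))⟩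

/-- Any element commutes with a left multiple of any given element. -/
theorem exists_central_multiple (x y s : ArtinMonoid) :
    ∃ c, RDvd s c ∧ x * c = c * x ∧ y * c = c * y := by
  obtain ⟨m, hm⟩ := exists_on_Iio (x * y * s)
  rw [on_mul, on_mul] at hm
  obtain ⟨k, hk⟩ := exists_rdvd_fullTwist_pow hm.2
  have hc : ∀ z, On (Set.Iio m) z → z * fullTwist m ^ k = fullTwist m ^ k * z := fun z hz =>
    (show Commute z (fullTwist m) from mul_fullTwist hz).pow_right k
  exact ⟨_, hk, hc x hm.1.1, hc y hm.1.2⟩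

theorem exists_ore (x s : ArtinMonoid) : ∃ a b, a * x = b * s := by
  obtain ⟨c, ⟨y, hy⟩, hx, -⟩ := exists_central_multiple x x s
  exact ⟨c, x * y, by rw [← hx, hy, mul_assoc]⟩

/-- Multiplying by `b` on the left turns `a` into an element that commutes with `x` and `y`; moved
to the right, it can be cancelled there. -/
instance : IsLeftCancelMul ArtinMonoid where
  mul_left_cancel a x y h := by
    obtain ⟨c, ⟨b, hb⟩, hx, hy⟩ := exists_central_multiple x y a
    have : c * x = c * y := by rw [hb, mul_assoc, mul_assoc]; exact congrArg _ h
    rw [← hx, ← hy] at this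
    exact mul_right_cancel this

/-! ### The group of fractions -/

noncomputable instance : OreLocalization.OreSet (⊤ : Submonoid ArtinMonoid) where
  ore_right_cancel x y s h := ⟨1, by rw [mul_right_cancel h]⟩
  oreNum x s := (exists_ore x s).choose_spec.choose
  oreDenom x s := ⟨(exists_ore x s).choose, trivial⟩
  ore_eq x s := (exists_ore x s).choose_spec.choose_spec

/-- The group of fractions of the Artin monoid. -/
abbrev FractionGroup : Type :=
  (OreLocalization (⊤ : Submonoid ArtinMonoid) ArtinMonoid)ˣ

/-- The map from the Artin monoid to its group of fractions. -/
noncomputable def toFraction (x : ArtinMonoid) : FractionGroup :=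
  OreLocalization.numeratorUnit ⟨x, trivial⟩

theorem toFraction_mul (x y : ArtinMonoid) : toFraction (x * y) = toFraction x * toFraction y :=
  Units.ext (map_mul (OreLocalization.numeratorHom (S := (⊤ : Submonoid ArtinMonoid))) x y)

theorem toFraction_one : toFraction 1 = 1 :=
  Units.ext (map_one (OreLocalization.numeratorHom (S := (⊤ : Submonoid ArtinMonoid))))

theorem toFraction_injective : Function.Injective toFraction := by
  intro x y h
  have h' : OreLocalization.oreDiv x (1 : (⊤ : Submonoid ArtinMonoid)) =
      OreLocalization.oreDiv y 1 := congrArg Units.val h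
  rw [OreLocalization.oreDiv_eq_iff] at h'
  obtain ⟨u, v, h1, h2⟩ := h'
  simp only [OneMemClass.coe_one, mul_one] at h2
  rw [← h2] at h1
  exact (mul_left_cancel (a := (u : ArtinMonoid)) h1).symm

end ArtinMonoid

/-! ### Positive words in the braid group and in the Artin monoid -/

open ArtinMonoid

/-- The homomorphism from the braid group to the group of fractions of the Artin monoid. -/
noncomputable def braidToFraction (n : ℕ) : BraidGroup n →* FractionGroup :=
  PresentedGroup.toGroup (f := fun i : Fin (n - 1) => toFraction (gen (i + 1))) (by
    rintro r (⟨i, j, h, rfl⟩ | ⟨i, j, h, rfl⟩)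
    · simp only [map_mul, map_inv, FreeGroup.lift_apply_of, mul_inv_eq_one, ← toFraction_mul]
      rw [gen_comm (Or.inl (by omega))]
    · simp only [map_mul, map_inv, FreeGroup.lift_apply_of, mul_inv_eq_one, ← toFraction_mul]
      rw [gen_braid (Or.inl (by omega))])

theorem braidToFraction_wordBraid {n : ℕ} {w : BraidWord} (hw : w.LettersIn (Set.Ico 1 n)) :
    braidToFraction n (wordBraid n w) = toFraction (ofWord w) := by
  induction w with
  | nil => simp [wordBraid, toFraction_one]
  | cons i w ih =>
    have hi : 1 ≤ i ∧ i < n := hw i (by simp)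
    have e : braidToFraction n (braidGen n i) = toFraction (gen i) := by
      rw [braidGen, dif_pos hi, braidToFraction, PresentedGroup.toGroup.of]
      simp [Nat.sub_add_cancel hi.1]
    have := ih (fun l hl => hw l (by simp [hl]))
    simp only [wordBraid] at this ⊢
    rw [List.map_cons, List.prod_cons, map_mul, this, e, ofWord_cons, toFraction_mul]

theorem braidGen_comm {n i j : ℕ} (hi : i ∈ Set.Ico 1 n) (hj : j ∈ Set.Ico 1 n)
    (h : i + 2 ≤ j) : braidGen n i * braidGen n j = braidGen n j * braidGen n i := by
  rw [braidGen, braidGen, dif_pos (Set.mem_Ico.1 hi), dif_pos (Set.mem_Ico.1 hj),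
    ← mul_inv_eq_one]
  refine (PresentedGroup.one_of_mem (rels := braidRels n)
    (Or.inl ⟨⟨i - 1, _⟩, ⟨j - 1, _⟩, ?_, rfl⟩))
  have := hi.1
  simp only
  omega

theorem braidGen_braid {n i : ℕ} (hi : i ∈ Set.Ico 1 n) (hj : i + 1 ∈ Set.Ico 1 n) :
    braidGen n i * braidGen n (i + 1) * braidGen n i =
      braidGen n (i + 1) * braidGen n i * braidGen n (i + 1) := by
  rw [braidGen, braidGen, dif_pos (Set.mem_Ico.1 hi), dif_pos (Set.mem_Ico.1 hj),
    ← mul_inv_eq_one]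
  refine (PresentedGroup.one_of_mem (rels := braidRels n)
    (Or.inr ⟨⟨i - 1, _⟩, ⟨i + 1 - 1, _⟩, ?_, rfl⟩))
  have := hi.1
  simp only
  omega

theorem wordBraid_append (n : ℕ) (u v : BraidWord) :
    wordBraid n (u ++ v) = wordBraid n u * wordBraid n v := by
  simp [wordBraid]

/-- Positive words represent the same element of the braid group if and only if they represent
the same element of the Artin monoid. -/
theorem wordBraid_eq_iff {n : ℕ} {u v : BraidWord} (hu : u.LettersIn (Set.Ico 1 n))
    (hv : v.LettersIn (Set.Ico 1 n)) : wordBraid n u = wordBraid n v ↔ ofWord u = ofWord v := by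
  classical
  constructor
  · intro h
    apply toFraction_injective
    rw [← braidToFraction_wordBraid hu, ← braidToFraction_wordBraid hv, h]
  · intro h
    -- Generators that do not exist in `B_n` go to the adjoined zero; `braidGen` would give them the
    -- value 1, which violates the braid relation at the ends.
    let φ : ArtinMonoid →* WithZero (BraidGroup n) :=
      lift (fun i => if i ∈ Set.Ico 1 n then (braidGen n i : WithZero (BraidGroup n)) else 0)
        (fun i j h => by
          split_ifs with hi hj
          · rw [← WithZero.coe_mul, ← WithZero.coe_mul, braidGen_comm hi hj h]
          all_goals simp)
        (fun i => by
          split_ifs with hi hj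
          · simp only [← WithZero.coe_mul, braidGen_braid hi hj]
          all_goals simp)
    have key : ∀ w : BraidWord, w.LettersIn (Set.Ico 1 n) →
        φ (ofWord w) = (wordBraid n w : BraidGroup n) := by
      intro w hw
      induction w with
      | nil => simp [wordBraid]
      | cons i w ih =>
        have hi : i ∈ Set.Ico 1 n := hw i (by simp)
        have : φ (gen i) = (braidGen n i : WithZero (BraidGroup n)) := if_pos hi
        rw [ofWord_cons, map_mul, ih (fun l hl => hw l (by simp [hl])), this, ← WithZero.coe_mul]
        simp [wordBraid]
    have := congrArg φ h
    rwa [key u hu, key v hv, WithZero.coe_inj] at this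

/-! ### The comparison of codes -/

theorem BraidCode.LtRight.ne {c c' : BraidCode} (h : BraidCode.LtRight c c') : c ≠ c' := by
  induction h with
  | exp h => intro e; cases e; exact lt_irrefl _ h
  | seq l _ _ ih => intro e; cases e; exact ih rfl

theorem BraidCode.LtRight.asymm {c c' : BraidCode} (h : BraidCode.LtRight c c') :
    ¬ BraidCode.LtRight c' c := by
  induction h with
  | exp h => intro h'; cases h' with | exp h' => exact lt_asymm h h'
  | @seq c c' l hl h ih =>
    intro h'
    cases h' with
    | seq l' hl' h' =>
      rcases lt_trichotomy l l' with hlt | rfl | hlt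
      · exact h.ne (hl' l hlt).symm
      · exact ih h'
      · exact h'.ne (hl l' hlt).symm

/-! ### Blocks -/

/-- The word `v_{k-1} ⋯ v_1 v_0`. -/
def stack (v : ℕ → BraidWord) : ℕ → BraidWord
  | 0 => []
  | k + 1 => v k ++ stack v k

theorem stack_congr {v w : ℕ → BraidWord} {k : ℕ} (h : ∀ j < k, v j = w j) :
    stack v k = stack w k := by
  induction k with
  | zero => rfl
  | succ k ih => rw [stack, stack, h k (by omega), ih fun j hj => h j (by omega)]

theorem stack_add (v : ℕ → BraidWord) (a b : ℕ) :
    stack v (a + b) = stack (fun i => v (a + i)) b ++ stack v a := by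
  induction b with
  | zero => simp [stack]
  | succ b ih => rw [← add_assoc, stack, ih, stack, List.append_assoc]

theorem stack_eq_of_empty {v : ℕ → BraidWord} {K K' : ℕ} (hK : K ≤ K')
    (hv : ∀ j, K ≤ j → j < K' → v j = []) : stack v K' = stack v K := by
  induction K', hK using Nat.le_induction with
  | base => rfl
  | succ K' h ih =>
    rw [stack, hv K' h (by omega), ih fun j h1 h2 => hv j h1 (by omega), List.nil_append]

theorem stack_lettersIn {v : ℕ → BraidWord} {S : Set ℕ} {k : ℕ}
    (h : ∀ j < k, (v j).LettersIn S) : (stack v k).LettersIn S := by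
  induction k with
  | zero => intro l hl; simp [stack] at hl
  | succ k ih =>
    intro l hl
    rw [stack, List.mem_append] at hl
    exact hl.elim (h k (by omega) l) (ih (fun j hj => h j (by omega)) l)

theorem concatBlocks_eq_stack (A : ℕ → BraidWord) (m : ℕ) :
    concatBlocks A m = stack A (m + 1) := by
  induction m with
  | zero => simp [concatBlocks, stack]
  | succ m ih =>
    rw [stack, ← ih, concatBlocks, concatBlocks, List.range_succ]
    simp

theorem flatten_range'_eq_stack (X : ℕ → BraidWord) (p : ℕ) :
    ((List.range' 1 p).map X).flatten = stack (fun j => X (p - j)) p := by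
  induction p generalizing X with
  | zero => rfl
  | succ p ih =>
    have e : List.range' 2 p = (List.range' 1 p).map (1 + ·) := by
      rw [List.map_add_range']
    rw [List.range'_succ, e, List.map_cons, List.map_map, List.flatten_cons, ih, stack]
    congr 1
    · congr 1; omega
    · refine stack_congr fun j hj => ?_
      simp only [Function.comp]
      congr 1
      omega

/-! ### Letters and renumberings of the blocks -/

/-- The letters of the `j`-th block, counted from the right, of a decomposition
`A_m ⋯ A_0 X_1 ⋯ X_{n-2}` for the Dehornoy ordering. -/
def codeLetters (n j : ℕ) : Set ℕ :=
  if j < n - 2 then Set.Ico (n - 1 - j) n else blockLetters n (j - (n - 2))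

/-- The number of strands on which the `j`-th block is coded. -/
def codeStrands (n j : ℕ) : ℕ := if j < n - 2 then j + 2 else n - 1

/-- The identification of the letters of the `j`-th block with generators on fewer strands. -/
def codeMap (n j : ℕ) : ℕ → ℕ :=
  if j < n - 2 then fun l => l - (n - 2 - j)
  else if j = n - 2 then fun l => l - 1
  else if Odd (j - (n - 2)) then id
  else fun l => n - l

/-- `f` and `g` are inverse bijections between `S` and `T` that preserve the braid relations. -/
structure LetterIso (f g : ℕ → ℕ) (S T : Set ℕ) : Prop where
  mapsTo : ∀ i ∈ S, f i ∈ T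
  mapsTo' : ∀ i ∈ T, g i ∈ S
  left_inv : ∀ i ∈ S, g (f i) = i
  right_inv : ∀ i ∈ T, f (g i) = i
  compat : IsRelabelling f S
  compat' : IsRelabelling g T

theorem letterIso_sub (s a b : ℕ) :
    LetterIso (fun l => l - s) (fun l => l + s) (Set.Ico (a + s) (b + s)) (Set.Ico a b) := by
  constructor <;> simp only [IsRelabelling, Adj, Far, Set.mem_Ico] <;> intros <;>
    omega

theorem letterIso_flip {n a b a' b' : ℕ} (ha : a + b' = n + 1) (hb : b + a' = n + 1) :
    LetterIso (fun l => n - l) (fun l => n - l) (Set.Ico a b) (Set.Ico a' b') := by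
  constructor <;> simp only [IsRelabelling, Adj, Far, Set.mem_Ico] <;> intros <;>
    omega

theorem letterIso_id (S : Set ℕ) : LetterIso id id S S :=
  ⟨fun _ h => h, fun _ h => h, fun _ _ => rfl, fun _ _ => rfl, fun _ _ _ _ => ⟨id, id⟩,
    fun _ _ _ _ => ⟨id, id⟩⟩

theorem codeMap_letterIso {n : ℕ} (hn : 3 ≤ n) (j : ℕ) :
    ∃ g, LetterIso (codeMap n j) g (codeLetters n j) (Set.Ico 1 (codeStrands n j)) := by
  unfold codeMap codeLetters codeStrands blockLetters
  by_cases h1 : j < n - 2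
  · simp only [if_pos h1]
    have := letterIso_sub (n - 2 - j) 1 (j + 2)
    rw [show 1 + (n - 2 - j) = n - 1 - j by omega, show j + 2 + (n - 2 - j) = n by omega] at this
    exact ⟨_, this⟩
  · simp only [if_neg h1]
    by_cases h2 : j = n - 2
    · simp only [h2, Nat.sub_self]
      have := letterIso_sub 1 1 (n - 1)
      rw [show n - 1 + 1 = n by omega] at this
      exact ⟨_, by simpa using this⟩
    · simp only [if_neg h2]
      split_ifs with h3
      · exact ⟨_, letterIso_id _⟩
      · exact ⟨_, letterIso_flip (by omega) (by omega)⟩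

theorem LetterIso.map_lettersIn {f g : ℕ → ℕ} {S T : Set ℕ} (h : LetterIso f g S T)
    {w : BraidWord} (hw : w.LettersIn S) : BraidWord.LettersIn (w.map f) T := by
  intro l hl
  obtain ⟨k, hk, rfl⟩ := List.mem_map.1 hl
  exact h.mapsTo k (hw k hk)

theorem LetterIso.symm {f g : ℕ → ℕ} {S T : Set ℕ} (h : LetterIso f g S T) : LetterIso g f T S :=
  ⟨h.mapsTo', h.mapsTo, h.right_inv, h.left_inv, h.compat', h.compat⟩

theorem LetterIso.map_map {f g : ℕ → ℕ} {S T : Set ℕ} (h : LetterIso f g S T) {w : BraidWord}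
    (hw : w.LettersIn S) : (w.map f).map g = w := by
  rw [List.map_map]
  conv_rhs => rw [← List.map_id w]
  exact List.map_congr_left fun l hl => h.left_inv l (hw l hl)

theorem LetterIso.map_injective {f g : ℕ → ℕ} {S T : Set ℕ} (h : LetterIso f g S T)
    {v w : BraidWord} (hv : v.LettersIn S) (hw : w.LettersIn S) (e : v.map f = w.map f) :
    v = w := by
  rw [← h.map_map hv, e, h.map_map hw]

theorem codeLetters_subset {n : ℕ} (hn : 3 ≤ n) (j : ℕ) : codeLetters n j ⊆ Set.Ico 1 n := by
  intro i hi
  simp only [codeLetters, blockLetters] at hi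
  split_ifs at hi <;> simp only [Set.mem_Ico] at hi ⊢ <;> omega

theorem codeStrands_lt {n : ℕ} (hn : 3 ≤ n) (j : ℕ) : codeStrands n j < n := by
  unfold codeStrands; split_ifs <;> omega

theorem two_le_codeStrands {n : ℕ} (hn : 3 ≤ n) (j : ℕ) : 2 ≤ codeStrands n j := by
  unfold codeStrands; split_ifs <;> omega

theorem flipWord_flipWord {n : ℕ} {w : BraidWord} (hw : w.LettersIn (Set.Ico 1 n)) :
    flipWord n (flipWord n w) = w :=
  (letterIso_flip (n := n) (a := 1) (b := n) (a' := 1) (b' := n) (by omega) (by omega)).map_map hw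

theorem flipWord_iterate {n : ℕ} {w : BraidWord} (hw : w.LettersIn (Set.Ico 1 n)) (i : ℕ) :
    (flipWord n)^[i] w = if Even i then w else flipWord n w := by
  induction i with
  | zero => simp
  | succ i ih =>
    rw [Function.iterate_succ_apply', ih]
    by_cases h : Even i
    · simp [h, Nat.even_add_one]
    · simp [h, Nat.even_add_one, flipWord_flipWord hw]

theorem blockLetters_subset (n i : ℕ) : blockLetters n i ⊆ Set.Ico 1 n := by
  intro l hl
  unfold blockLetters at hl
  split_ifs at hl <;> simp only [Set.mem_Ico] at hl ⊢ <;> omega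

/-- The flip is an involution, so only the parity of `i - 1` matters, and the identifications used
for codes and for the alternating form agree. -/
theorem map_codeMap {n i : ℕ} {w : BraidWord} (hi : 1 ≤ i)
    (hw : w.LettersIn (blockLetters n i)) :
    w.map (codeMap n (n - 2 + i)) = (flipWord n)^[i - 1] w := by
  rw [flipWord_iterate fun l hl => blockLetters_subset n i (hw l hl)]
  obtain ⟨i, rfl⟩ : ∃ k, i = k + 1 := ⟨i - 1, by omega⟩
  have h1 : ¬ (n - 2 + (i + 1) < n - 2) := by omega
  have h2 : ¬ (n - 2 + (i + 1) = n - 2) := by omega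
  simp only [codeMap, if_neg h1, if_neg h2, Nat.add_sub_cancel, Nat.add_sub_cancel_left,
    Nat.odd_add_one, Nat.not_odd_iff_even]
  split_ifs
  · simp
  · rfl

/-! ### Codes for the trivial permutation -/

theorem diagramArc_dehornoyDiagram {n j : ℕ} (hj : j + 1 < n) :
    diagramArc (dehornoyDiagram n) (j + 1) = j + 1 := by
  simp only [diagramArc, dehornoyDiagram, Nat.add_sub_cancel]
  rw [List.getD_eq_getElem _ _ (by simp; omega)]
  simp [add_comm]

theorem take_dehornoyDiagram {n j : ℕ} (hj : j + 1 < n) :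
    (dehornoyDiagram n).take j = List.range' 1 j := by
  have e : List.range' 1 (n - 1) = List.range' 1 j ++ List.range' (1 + j) (n - 1 - j) := by
    rw [List.range'_append_1]; congr 1; omega
  rw [dehornoyDiagram, e, List.take_left' (by simp)]

theorem lowerEnd_dehornoyDiagram {n j : ℕ} (hj : j + 1 < n) :
    lowerEnd (dehornoyDiagram n) j = j + 1 := by
  rw [lowerEnd, diagramArc_dehornoyDiagram hj, take_dehornoyDiagram hj,
    List.filter_eq_self.2 (by simp; omega)]
  have key : ∀ k s, (((List.range' s (k + 1)).map fun a => a + 1).foldr max 1) = s + k + 1 := by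
    intro k
    induction k with
    | zero => simp
    | succ k ih =>
      intro s
      rw [List.range'_succ, List.map_cons, List.foldr_cons, ih]
      omega
  cases j with
  | zero => rfl
  | succ j => rw [key]; omega

theorem upperEnd_dehornoyDiagram {n j : ℕ} (hj : j + 1 < n) :
    upperEnd n (dehornoyDiagram n) j = n := by
  rw [upperEnd, diagramArc_dehornoyDiagram hj, take_dehornoyDiagram hj,
    List.filter_eq_nil_iff.2 (by simp; omega)]
  rfl

theorem restrictDiagram_dehornoyDiagram {n s : ℕ} (hs : s < n) :
    restrictDiagram (dehornoyDiagram n) (s + 1) n = dehornoyDiagram (n - s) := by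
  have e : List.range' 1 (n - 1) = List.range' 1 s ++ List.range' (1 + s) (n - s - 1) := by
    rw [List.range'_append_1]; congr 1; omega
  rw [restrictDiagram, dehornoyDiagram, dehornoyDiagram, e, List.filter_append,
    List.filter_eq_nil_iff.2 (by simp; omega), List.filter_eq_self.2 (by simp; omega),
    List.nil_append, Nat.add_sub_cancel, List.map_sub_range' (by omega), Nat.add_sub_cancel]

/-- For the trivial permutation `m_j = j + 1` and `M_j = n`. Numbering the `X` and the `A` together
from the right, as the entries of the code are numbered, puts all blocks under one uniform
condition. -/
theorem hasCode_iff_blocks {n : ℕ} (hn : 3 ≤ n) {W : BraidWord} {C : BraidCode} :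
    HasCode n (dehornoyDiagram n) W C ↔
      ∃ (v : ℕ → BraidWord) (c : ℕ → BraidCode) (K : ℕ), C = BraidCode.seq c ∧ W = stack v K ∧
        (∀ j, K ≤ j → v j = []) ∧ (∀ j, (v j).LettersIn (codeLetters n j)) ∧
        ∀ j, HasCode (codeStrands n j) (dehornoyDiagram (codeStrands n j))
          ((v j).map (codeMap n j)) (c j) := by
  have hlow : ∀ j ∈ Set.Icc 1 (n - 2), lowerEnd (dehornoyDiagram n) j = j + 1 :=
    fun j hj => lowerEnd_dehornoyDiagram (by rw [Set.mem_Icc] at hj; omega)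
  have hup : ∀ j ∈ Set.Icc 1 (n - 2), upperEnd n (dehornoyDiagram n) j = n :=
    fun j hj => upperEnd_dehornoyDiagram (by rw [Set.mem_Icc] at hj; omega)
  have hres : ∀ j ∈ Set.Icc 1 (n - 2),
      restrictDiagram (dehornoyDiagram n) (j + 1) n = dehornoyDiagram (n - j) :=
    fun j hj => restrictDiagram_dehornoyDiagram (by rw [Set.mem_Icc] at hj; omega)
  have hstr : ∀ j ∈ Set.Icc 1 (n - 2), n - (j + 1) + 1 = n - j :=
    fun j hj => by rw [Set.mem_Icc] at hj; omega
  have hS1 : ∀ j, j < n - 2 → codeStrands n j = j + 2 := fun j hj => if_pos hj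
  have hS2 : ∀ j, ¬ j < n - 2 → codeStrands n j = n - 1 := fun j hj => if_neg hj
  have hL1 : ∀ j, j < n - 2 → codeLetters n j = Set.Ico (n - 1 - j) n := fun j hj => if_pos hj
  have hL2 : ∀ j, ¬ j < n - 2 → codeLetters n j = blockLetters n (j - (n - 2)) :=
    fun j hj => if_neg hj
  have hM1 : ∀ j, j < n - 2 → codeMap n j = fun l => l - (n - 2 - j) := fun j hj => if_pos hj
  have hM2 : codeMap n (n - 2) = fun l => l - 1 := by simp [codeMap]
  have hR0 : restrictDiagram (dehornoyDiagram n) 2 n = dehornoyDiagram (n - 1) :=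
    restrictDiagram_dehornoyDiagram (s := 1) (by omega)
  constructor
  · intro h
    generalize hk : dehornoyDiagram n = k at h
    cases h with
    | two a => omega
    | step n k hn hkn m A X c hA hm hX hcA hcA0 hcX =>
      subst hk
      let v : ℕ → BraidWord := fun j => if j < n - 2 then X (n - 2 - j) else A (j - (n - 2))
      have hv1 : ∀ j, j < n - 2 → v j = X (n - 2 - j) := fun j hj => if_pos hj
      have hv2 : ∀ j, ¬ j < n - 2 → v j = A (j - (n - 2)) := fun j hj => if_neg hj
      refine ⟨v, c, n - 2 + (m + 1), rfl, ?_, ?_, ?_, ?_⟩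
      · rw [concatBlocks_eq_stack, flatten_range'_eq_stack, stack_add v (n - 2) (m + 1)]
        congr 1
        · refine stack_congr fun j _ => ?_
          rw [hv2 _ (by omega), Nat.add_sub_cancel_left]
        · exact stack_congr fun j hj => (hv1 j hj).symm
      · intro j hj
        rw [hv2 j (by omega)]
        exact hm _ (by omega)
      · intro j
        by_cases hj : j < n - 2
        · have hj' : n - 2 - j ∈ Set.Icc 1 (n - 2) := by rw [Set.mem_Icc]; omega
          have := hX _ hj'
          rw [hlow _ hj', hup _ hj'] at this
          rw [hv1 j hj, hL1 j hj]
          rwa [show n - 1 - j = n - 2 - j + 1 by omega]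
        · rw [hv2 j hj, hL2 j hj]
          exact hA _
      · intro j
        by_cases hj : j < n - 2
        · have hj' : n - 2 - j ∈ Set.Icc 1 (n - 2) := by rw [Set.mem_Icc]; omega
          have := hcX _ hj'
          rw [hlow _ hj', hup _ hj', hres _ hj', hstr _ hj', Nat.add_sub_cancel, shiftWord,
            show n - (n - 2 - j) = j + 2 by omega, show n - 2 - (n - 2 - j) = j by omega] at this
          rwa [hS1 j hj, hv1 j hj, hM1 j hj]
        · rw [hS2 j hj, hv2 j hj]
          obtain ⟨i, rfl⟩ : ∃ i, j = n - 2 + i := ⟨j - (n - 2), by omega⟩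
          rw [Nat.add_sub_cancel_left]
          rcases Nat.eq_zero_or_pos i with rfl | hi
          · rw [add_zero, hM2]
            rwa [hR0] at hcA0
          · rw [map_codeMap hi (hA i)]
            exact hcA i hi
  · rintro ⟨v, c, K, rfl, rfl, hK, hv, hc⟩
    have hB : ∀ i, (v (n - 2 + i)).LettersIn (blockLetters n i) := fun i => by
      have := hv (n - 2 + i)
      rwa [hL2 _ (by omega), Nat.add_sub_cancel_left] at this
    have e : stack v K = concatBlocks (fun i => v (n - 2 + i)) K ++
        ((List.range' 1 (n - 2)).map fun j => v (n - 2 - j)).flatten := by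
      rw [concatBlocks_eq_stack, flatten_range'_eq_stack,
        ← stack_eq_of_empty (show K ≤ n - 2 + (K + 1) by omega) fun j h _ => hK j h, stack_add]
      congr 1
      refine stack_congr fun j hj => ?_
      congr 1
      omega
    rw [e]
    -- The value `K` for the number `m` is larger than needed; the surplus blocks are empty.
    refine HasCode.step n _ hn (isNormalDiagram_dehornoyDiagram n) K _ _ c hB
      (fun i hi => hK _ (by omega)) ?_ ?_ ?_ ?_
    · intro j hj
      rw [hlow j hj, hup j hj]
      rw [Set.mem_Icc] at hj
      have := hv (n - 2 - j)
      rwa [hL1 _ (by omega), show n - 1 - (n - 2 - j) = j + 1 by omega] at this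
    · intro i hi
      have := hc (n - 2 + i)
      rwa [hS2 _ (by omega), map_codeMap hi (hB i)] at this
    · have := hc (n - 2)
      rw [hS2 _ (by omega), hM2] at this
      rwa [hR0]
    · intro j hj
      rw [hlow j hj, hup j hj, hres j hj, hstr j hj]
      rw [Set.mem_Icc] at hj
      have := hc (n - 2 - j)
      rwa [hS1 _ (by omega), hM1 _ (by omega), show n - 2 - j + 2 = n - j by omega,
        show n - 2 - (n - 2 - j) = j by omega] at this

theorem hasCode_two {W : BraidWord} {C : BraidCode} :
    HasCode 2 (dehornoyDiagram 2) W C ↔ ∃ a, W = List.replicate a 1 ∧ C = BraidCode.exp a := by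
  constructor
  · intro h
    generalize hk : dehornoyDiagram 2 = k at h
    generalize hn : 2 = n at h
    cases h with
    | two a => exact ⟨a, rfl, rfl⟩
    | step n k hn' => omega
  · rintro ⟨a, rfl, rfl⟩
    exact HasCode.two a

/-- A code determines the word. -/
theorem HasCode.word_unique {n : ℕ} (hn : 2 ≤ n) {v w : BraidWord} {C : BraidCode}
    (hv : HasCode n (dehornoyDiagram n) v C) (hw : HasCode n (dehornoyDiagram n) w C) : v = w := by
  induction n using Nat.strong_induction_on generalizing v w C with
  | _ n ih =>
  rcases hn.eq_or_lt with rfl | hn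
  · obtain ⟨a, rfl, rfl⟩ := hasCode_two.1 hv
    obtain ⟨b, rfl, h⟩ := hasCode_two.1 hw
    cases h
    rfl
  · obtain ⟨v, c, K, rfl, rfl, hK, hv, hc⟩ := (hasCode_iff_blocks hn).1 hv
    obtain ⟨w, c', K', h, rfl, hK', hw, hc'⟩ := (hasCode_iff_blocks hn).1 hw
    cases h
    rw [← stack_eq_of_empty (le_max_left K K') fun j h _ => hK j h,
      ← stack_eq_of_empty (le_max_right K K') fun j h _ => hK' j h]
    refine stack_congr fun j _ => ?_
    obtain ⟨g, hg⟩ := codeMap_letterIso hn j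
    exact hg.map_injective (hv j) (hw j)
      (ih _ (codeStrands_lt hn j) (two_le_codeStrands hn j) (hc j) (hc' j))

/-! ### Maximal right divisors in the braid group -/

theorem mem_parabolicMonoid_iff {n : ℕ} {S : Set ℕ} {δ : BraidGroup n} :
    δ ∈ parabolicMonoid n S ↔ ∃ w : BraidWord, w.LettersIn S ∧ wordBraid n w = δ := by
  constructor
  · intro h
    induction h using Submonoid.closure_induction with
    | mem x hx =>
      obtain ⟨i, hi, rfl⟩ := hx
      exact ⟨[i], by simpa [BraidWord.LettersIn] using hi, by simp [wordBraid]⟩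
    | one => exact ⟨[], by simp [BraidWord.LettersIn], by simp [wordBraid]⟩
    | mul x y _ _ hx hy =>
      obtain ⟨u, hu, rfl⟩ := hx
      obtain ⟨v, hv, rfl⟩ := hy
      refine ⟨u ++ v, fun l hl => ?_, wordBraid_append n u v⟩
      exact (List.mem_append.1 hl).elim (hu l) (hv l)
  · rintro ⟨w, hw, rfl⟩
    refine Submonoid.list_prod_mem _ fun x hx => ?_
    obtain ⟨i, hi, rfl⟩ := List.mem_map.1 hx
    exact Submonoid.subset_closure ⟨i, hw i hi, rfl⟩

theorem BraidWord.LettersIn.append {u v : BraidWord} {S : Set ℕ} (hu : u.LettersIn S)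
    (hv : v.LettersIn S) : BraidWord.LettersIn (u ++ v) S :=
  fun l hl => (List.mem_append.1 hl).elim (hu l) (hv l)

theorem BraidWord.LettersIn.mono {u : BraidWord} {S T : Set ℕ} (hu : u.LettersIn S)
    (h : S ⊆ T) : u.LettersIn T := fun l hl => h (hu l hl)

theorem lettersIn_nil (S : Set ℕ) : BraidWord.LettersIn [] S := by simp [BraidWord.LettersIn]

theorem eq_nil_of_ofWord_eq_one {w : BraidWord} (h : ofWord w = 1) : w = [] := by
  have := congrArg len h
  rwa [len_ofWord, len_one, List.length_eq_zero_iff] at this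

theorem eq_nil_of_wordBraid_eq_one {n : ℕ} {w : BraidWord} (hw : w.LettersIn (Set.Ico 1 n))
    (h : wordBraid n w = 1) : w = [] :=
  eq_nil_of_ofWord_eq_one ((wordBraid_eq_iff hw (lettersIn_nil _)).1 (h.trans rfl))

/-- Each condition that a quotient in the group is positive becomes, after multiplying out, an
equation between positive words, which `wordBraid_eq_iff` moves to the monoid. -/
theorem isMaxRightDivisor_of_isMaxDiv {n : ℕ} {S : Set ℕ} (hS : S ⊆ Set.Ico 1 n)
    {u d : BraidWord} (hu : u.LettersIn (Set.Ico 1 n))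
    (h : IsMaxDiv S (ofWord u) (ofWord d)) :
    IsMaxRightDivisor n S (wordBraid n u) (wordBraid n d) := by
  have hd := on_ofWord.1 h.on
  refine ⟨mem_parabolicMonoid_iff.2 ⟨d, hd, rfl⟩, ?_, ?_⟩
  · obtain ⟨y, hy⟩ := h.rdvd
    obtain ⟨y, rfl⟩ := exists_ofWord y
    have hyl : BraidWord.LettersIn y (Set.Ico 1 n) := by
      rw [← on_ofWord, hy, on_mul] at hu
      exact on_ofWord.1 hu.1
    refine mem_parabolicMonoid_iff.2 ⟨y, hyl, ?_⟩
    rw [eq_mul_inv_iff_mul_eq, ← wordBraid_append, wordBraid_eq_iff (hyl.append (hd.mono hS)) hu,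
      hy, ofWord_append]
  · intro δ hδ hβ
    obtain ⟨e, he, rfl⟩ := mem_parabolicMonoid_iff.1 hδ
    obtain ⟨y, hy, h'⟩ := mem_parabolicMonoid_iff.1 hβ
    rw [eq_mul_inv_iff_mul_eq, ← wordBraid_append, wordBraid_eq_iff (hy.append (he.mono hS)) hu,
      ofWord_append] at h'
    obtain ⟨z, hz⟩ := h.max (ofWord e) (on_ofWord.2 he) ⟨ofWord y, h'.symm⟩
    obtain ⟨z, rfl⟩ := exists_ofWord z
    have hzl : BraidWord.LettersIn z S := by
      have := h.on
      rw [hz, on_mul] at this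
      exact on_ofWord.1 this.1
    refine mem_parabolicMonoid_iff.2 ⟨z, hzl, ?_⟩
    rw [eq_mul_inv_iff_mul_eq, ← wordBraid_append,
      wordBraid_eq_iff ((hzl.append he).mono hS) (hd.mono hS), hz, ofWord_append]

theorem IsMaxRightDivisor.unique {n : ℕ} {S : Set ℕ} (hS : S ⊆ Set.Ico 1 n)
    {β δ δ' : BraidGroup n} (h : IsMaxRightDivisor n S β δ) (h' : IsMaxRightDivisor n S β δ') :
    δ = δ' := by
  obtain ⟨a, ha, e⟩ := mem_parabolicMonoid_iff.1 (h.2.2 δ' h'.1 h'.2.1)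
  obtain ⟨b, hb, e'⟩ := mem_parabolicMonoid_iff.1 (h'.2.2 δ h.1 h.2.1)
  have := eq_nil_of_wordBraid_eq_one ((ha.append hb).mono hS)
    (by rw [wordBraid_append, e, e']; group)
  rw [(List.append_eq_nil_iff.1 this).1] at e
  exact (mul_inv_eq_one.1 e.symm)

/-- If `β` has only the trivial right divisor in `S`, its maximal right divisor is trivial. -/
theorem IsMaxRightDivisor.eq_one {n : ℕ} {S : Set ℕ} (hS : S ⊆ Set.Ico 1 n) {u : BraidWord}
    (hu : u.LettersIn (Set.Ico 1 n)) {δ : BraidGroup n}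
    (hone : ∀ d, On S d → RDvd d (ofWord u) → d = 1)
    (h : IsMaxRightDivisor n S (wordBraid n u) δ) : δ = 1 := by
  have := isMaxDiv_mul (on_one S) hone
  rw [mul_one] at this
  exact h.unique hS (isMaxRightDivisor_of_isMaxDiv (d := []) hS hu this)

theorem isMaxRightDivisor_one {n : ℕ} {S : Set ℕ} (hS : S ⊆ Set.Ico 1 n) {δ : BraidGroup n}
    (h : IsMaxRightDivisor n S 1 δ) : δ = 1 := by
  refine IsMaxRightDivisor.eq_one (u := []) hS (lettersIn_nil _) ?_ h
  rintro d - ⟨y, hy⟩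
  exact (eq_one_of_mul_eq_one hy.symm).2

/-! ### Uniqueness of the alternating normal form -/

theorem blockToLower_eq_map {n i : ℕ} {w : BraidWord} :
    blockToLower n i w = w.map (codeMap n (n - 2 + i)) := by
  unfold blockToLower codeMap shiftWord flipWord
  rcases Nat.eq_zero_or_pos i with rfl | hi
  · simp
  · have h1 : ¬ (n - 2 + i < n - 2) := by omega
    have h2 : ¬ (n - 2 + i = n - 2) := by omega
    simp only [if_neg hi.ne', if_neg h1, if_neg h2, Nat.add_sub_cancel_left]
    split_ifs <;> simp

theorem codeLetters_add (n i : ℕ) : codeLetters n (n - 2 + i) = blockLetters n i := by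
  rw [codeLetters, if_neg (by omega), Nat.add_sub_cancel_left]

theorem codeStrands_add (n i : ℕ) : codeStrands n (n - 2 + i) = n - 1 :=
  if_neg (by omega)

theorem blockToLower_letterIso {n : ℕ} (hn : 3 ≤ n) (i : ℕ) :
    ∃ g, LetterIso (codeMap n (n - 2 + i)) g (blockLetters n i) (Set.Ico 1 (n - 1)) := by
  rw [← codeLetters_add, ← codeStrands_add n i]
  exact codeMap_letterIso hn _

theorem isPhiNormalForm_two {β : BraidGroup 2} {w : BraidWord} (h : IsPhiNormalForm 2 β w) :
    ∃ a, w = List.replicate a 1 ∧ β = wordBraid 2 w := by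
  cases h with
  | two a => exact ⟨a, rfl, by simp [wordBraid]⟩
  | step n hn => omega

theorem IsPhiNormalForm.exists_blocks {n : ℕ} (hn : 3 ≤ n) {β : BraidGroup n} {W : BraidWord}
    (h : IsPhiNormalForm n β W) : ∃ (m : ℕ) (b : ℕ → BraidGroup n) (w : ℕ → BraidWord),
      W = stack w (m + 1) ∧ IsAlternateDecomposition n β m b ∧
      (∀ i ≤ m, (w i).LettersIn (blockLetters n i) ∧ wordBraid n (w i) = b i) ∧
      ∀ i ≤ m, IsPhiNormalForm (n - 1) (wordBraid (n - 1) (blockToLower n i (w i)))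
        (blockToLower n i (w i)) := by
  cases h with
  | two a => omega
  | step _ _ _ m b w hb hw hrec => exact ⟨m, b, w, concatBlocks_eq_stack w m, hb, hw, hrec⟩

theorem lettersIn_replicate_one (a : ℕ) :
    BraidWord.LettersIn (List.replicate a 1) (Set.Ico 1 2) := by
  intro l hl
  rw [List.eq_of_mem_replicate hl]
  simp

/-- The number `m` is not part of the braid: a decomposition may have trivial blocks on the left. Up
to the smaller `m` the blocks agree, and the remaining ones are divisors of 1. -/
theorem IsPhiNormalForm.unique {n : ℕ} (hn : 2 ≤ n) {β : BraidGroup n} {v w : BraidWord}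
    (hv : IsPhiNormalForm n β v) (hw : IsPhiNormalForm n β w) : v = w := by
  induction n using Nat.strong_induction_on generalizing v w with
  | _ n ih =>
  rcases hn.eq_or_lt with rfl | hn
  · obtain ⟨a, rfl, ha⟩ := isPhiNormalForm_two hv
    obtain ⟨b, rfl, hb⟩ := isPhiNormalForm_two hw
    rw [ha, wordBraid_eq_iff (lettersIn_replicate_one a) (lettersIn_replicate_one b)] at hb
    have := congrArg len hb
    simp only [len_ofWord, List.length_replicate] at this
    rw [this]
  · replace hv := hv.exists_blocks hn
    replace hw := hw.exists_blocks hn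
    obtain ⟨m, b, v, rfl, hb, hv, hrec⟩ := hv
    obtain ⟨m', b', w, rfl, hb', hw, hrec'⟩ := hw
    wlog hm : m ≤ m' generalizing m b v m' b' w
    · exact (this m' b' w hb' hw hrec' m b v hb hv hrec (by omega)).symm
    have hrem : ∀ i ≤ m + 1, remainder β b i = remainder β b' i := by
      intro i hi
      induction i with
      | zero => rfl
      | succ i ihi =>
        have e := ihi (by omega)
        have h1 := hb.1 i (by omega)
        rw [e] at h1
        rw [remainder, remainder, e,
          h1.unique (blockLetters_subset n i) (hb'.1 i (by omega))]
    have hbb : ∀ i ≤ m, b i = b' i := by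
      intro i hi
      have h1 := hb.1 i hi
      rw [hrem i (by omega)] at h1
      exact h1.unique (blockLetters_subset n i) (hb'.1 i (by omega))
    have hone : ∀ k, m + 1 + k ≤ m' + 1 → remainder β b' (m + 1 + k) = 1 := by
      intro k hk
      induction k with
      | zero => rw [add_zero, ← hrem _ le_rfl, hb.2]
      | succ k ihk =>
        have e := ihk (by omega)
        have h1 := hb'.1 (m + 1 + k) (by omega)
        rw [e] at h1
        rw [← add_assoc, remainder, e, isMaxRightDivisor_one (blockLetters_subset _ _) h1]
        simp
    rw [stack_eq_of_empty (K := m + 1) (K' := m' + 1) (v := w) (by omega)]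
    · refine stack_congr fun i hi => ?_
      have hi' : i ≤ m := by omega
      obtain ⟨g, hg⟩ := blockToLower_letterIso hn i
      have hvi := hv i hi'
      have hwi := hw i (by omega)
      have h1 := hrec i hi'
      have h2 := hrec' i (by omega)
      rw [blockToLower_eq_map] at h1 h2
      refine hg.map_injective hvi.1 hwi.1 (ih (n - 1) (by omega) (by omega) h1 ?_)
      rw [(wordBraid_eq_iff (hg.map_lettersIn hvi.1) (hg.map_lettersIn hwi.1)).2]
      · exact h2
      · refine ofWord_map hg.compat hvi.1 ?_
        rw [← wordBraid_eq_iff (hvi.1.mono (blockLetters_subset n i))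
          (hwi.1.mono (blockLetters_subset n i)), hvi.2, hwi.2, hbb i hi']
    · intro i hi hi'
      obtain ⟨k, rfl⟩ : ∃ k, i = m + 1 + k := ⟨i - (m + 1), by omega⟩
      have h1 := hb'.1 (m + 1 + k) (by omega)
      rw [hone k (by omega)] at h1
      have h2 := hw (m + 1 + k) (by omega)
      refine eq_nil_of_wordBraid_eq_one (h2.1.mono (blockLetters_subset _ _)) ?_
      rw [h2.2, isMaxRightDivisor_one (blockLetters_subset _ _) h1]

/-! ### Construction of alternating normal forms -/

theorem isAlternateDecomposition_of_isMaxDiv {n m : ℕ} {r w : ℕ → BraidWord}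
    (hr : ∀ i, (r i).LettersIn (Set.Ico 1 n))
    (hmax : ∀ i, IsMaxDiv (blockLetters n i) (ofWord (r i)) (ofWord (w i)))
    (hrec : ∀ i, ofWord (r i) = ofWord (r (i + 1)) * ofWord (w i))
    (hm : ofWord (r (m + 1)) = 1) :
    IsAlternateDecomposition n (wordBraid n (r 0)) m (fun i => wordBraid n (w i)) := by
  have hrem : ∀ i, remainder (wordBraid n (r 0)) (fun i => wordBraid n (w i)) i =
      wordBraid n (r i) := by
    intro i
    induction i with
    | zero => rfl
    | succ i ih =>
      rw [remainder, ih, mul_inv_eq_iff_eq_mul, ← wordBraid_append, wordBraid_eq_iff (hr i),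
        hrec i, ofWord_append]
      exact (hr (i + 1)).append ((on_ofWord.1 (hmax i).on).mono (blockLetters_subset n i))
  refine ⟨fun i _ => ?_, ?_⟩
  · rw [hrem]
    exact isMaxRightDivisor_of_isMaxDiv (blockLetters_subset n i) (hr i) (hmax i)
  · rw [hrem, eq_nil_of_ofWord_eq_one hm]
    rfl

/-- The alternating normal form of `p q`, where `p` has no right divisor among the braids in
`σ_2, …, σ_{n-1}` and `q` is such a braid. -/
theorem IsPhiNormalForm.append {n : ℕ} (hn : 3 ≤ n) {p q : BraidWord}
    (hpl : p.LettersIn (Set.Ico 1 n))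
    (hp : IsPhiNormalForm n (wordBraid n p) p)
    (hone : ∀ d, On (Set.Ico 2 n) d → RDvd d (ofWord p) → d = 1)
    (hql : q.LettersIn (Set.Ico 2 n))
    (hq : IsPhiNormalForm (n - 1) (wordBraid (n - 1) (shiftWord 1 q)) (shiftWord 1 q)) :
    IsPhiNormalForm n (wordBraid n (p ++ q)) (p ++ q) := by
  obtain ⟨m, b, w, e, hb, hw, hrec⟩ := hp.exists_blocks hn
  have hB0 : blockLetters n 0 = Set.Ico 2 n := by simp [blockLetters]
  have hI : Set.Ico 2 n ⊆ Set.Ico 1 n := Set.Ico_subset_Ico_left (by omega)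
  have hb0 : b 0 = 1 := by
    have := hb.1 0 (by omega)
    rw [hB0] at this
    exact this.eq_one hI hpl hone
  have hw0 : w 0 = [] := by
    have := hw 0 (by omega)
    exact eq_nil_of_wordBraid_eq_one (this.1.mono (blockLetters_subset n 0)) (this.2.trans hb0)
  -- Block 0 of `p` is empty, so `q` takes its place; the later remainders do not change.
  let b' : ℕ → BraidGroup n := fun i => if i = 0 then wordBraid n q else b i
  let w' : ℕ → BraidWord := fun i => if i = 0 then q else w i
  have hrem : ∀ i, remainder (wordBraid n (p ++ q)) b' (i + 1) =
      remainder (wordBraid n p) b (i + 1) := by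
    intro i
    induction i with
    | zero => simp [remainder, b', hb0, wordBraid_append]
    | succ i ih => rw [remainder, ih, remainder]; rfl
  have e' : p ++ q = concatBlocks w' m := by
    rw [concatBlocks_eq_stack, e, add_comm m 1, stack_add, stack_add]
    simp [stack, hw0, w']
  have key : IsPhiNormalForm n (wordBraid n (p ++ q)) (concatBlocks w' m) := by
    refine IsPhiNormalForm.step n hn _ m b' w' ⟨?_, (hrem m).trans hb.2⟩ ?_ ?_
    · intro i hi
      cases i with
      | zero =>
        refine isMaxRightDivisor_of_isMaxDiv (blockLetters_subset n 0)
          (hpl.append (hql.mono hI)) ?_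
        rw [ofWord_append, hB0]
        exact isMaxDiv_mul (on_ofWord.2 hql) hone
      | succ i =>
        rw [hrem]
        exact hb.1 (i + 1) hi
    · intro i hi
      cases i with
      | zero => exact ⟨by rwa [hB0], rfl⟩
      | succ i => exact hw (i + 1) hi
    · intro i hi
      cases i with
      | zero => exact hq
      | succ i => exact hrec (i + 1) hi
  rwa [← e'] at key

/-- The alternating normal form of a product of greedy blocks `w_k ⋯ w_1 w_0` in the letters
`σ_{n-1-k}, …, σ_{n-1}`. -/
theorem isPhiNormalForm_stack {n : ℕ} {w : ℕ → BraidWord}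
    (hw : ∀ j < n - 2, (w j).LettersIn (Set.Ico (n - 1 - j) n))
    (hphi : ∀ j < n - 2, IsPhiNormalForm (j + 2) (wordBraid (j + 2) (shiftWord (n - 2 - j) (w j)))
      (shiftWord (n - 2 - j) (w j)))
    (hone : ∀ j, j + 1 < n - 2 → ∀ d, On (Set.Ico (n - 1 - j) n) d →
      RDvd d (ofWord (w (j + 1))) → d = 1) (k : ℕ) (hk : k < n - 2) :
    IsPhiNormalForm (k + 2) (wordBraid (k + 2) (shiftWord (n - 2 - k) (stack w (k + 1))))
      (shiftWord (n - 2 - k) (stack w (k + 1))) := by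
  induction k with
  | zero =>
    have := hphi 0 hk
    simpa [stack] using this
  | succ k ih =>
    have ih := ih (by omega)
    obtain ⟨s, rfl⟩ : ∃ s, n = k + 3 + s := ⟨n - (k + 3), by omega⟩
    have hs : k + 3 + s - 2 - (k + 1) = s := by omega
    have hs' : k + 3 + s - 2 - k = s + 1 := by omega
    have hs1 : k + 3 + s - 1 - (k + 1) = 1 + s := by omega
    have hs2 : k + 3 + s - 1 - k = 2 + s := by omega
    rw [hs'] at ih
    have e : shiftWord s (stack w (k + 1 + 1)) =
        shiftWord s (w (k + 1)) ++ shiftWord s (stack w (k + 1)) := by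
      simp [stack, shiftWord]
    have hiso := letterIso_sub s 1 (k + 3)
    have hiso2 := letterIso_sub s 2 (k + 3)
    have hwk := hw (k + 1) hk
    rw [hs1] at hwk
    have hphik := hphi (k + 1) hk
    rw [hs] at hphik ⊢
    rw [e]
    -- On `k + 3` strands the new block is `p`, and the stack built so far, which avoids the first
    -- generator, is `q`.
    refine IsPhiNormalForm.append (n := k + 3) (by omega) (hiso.map_lettersIn hwk) hphik ?_
      (hiso2.map_lettersIn (stack_lettersIn fun j hj => (hw j (by omega)).mono
        (Set.Ico_subset_Ico_left (by omega)))) ?_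
    · rintro d hd ⟨y, hy⟩
      obtain ⟨d, rfl⟩ := exists_ofWord d
      obtain ⟨y, rfl⟩ := exists_ofWord y
      rw [on_ofWord] at hd
      rw [← ofWord_append] at hy
      have h1 := ofWord_map hiso.symm.compat (hiso.map_lettersIn hwk) hy
      rw [hiso.map_map hwk, List.map_append, ofWord_append] at h1
      have h2 := hone k hk (ofWord (d.map fun l => l + s))
        (by rw [hs2]; exact on_ofWord.2 (hiso2.symm.map_lettersIn hd)) ⟨_, h1⟩
      rw [List.map_eq_nil_iff.1 (eq_nil_of_ofWord_eq_one h2), ofWord_nil]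
    · have e2 : shiftWord 1 (shiftWord s (stack w (k + 1))) =
          shiftWord (s + 1) (stack w (k + 1)) := by
        simp [shiftWord, Function.comp_def, Nat.sub_sub]
      rw [e2]
      exact ih

/-! ### Greedy decompositions and the greatest code -/

/-- The greedy decomposition of `x` with respect to a sequence of letter sets. -/
theorem exists_greedy (T : ℕ → Set ℕ) (x : ArtinMonoid) : ∃ R G : ℕ → ArtinMonoid,
    R 0 = x ∧ (∀ j, R j = R (j + 1) * G j) ∧ ∀ j, IsMaxDiv (T j) (R j) (G j) := by
  have h : ∀ (S : Set ℕ) (x : ArtinMonoid), ∃ y d, x = y * d ∧ IsMaxDiv S x d := fun S x => by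
    obtain ⟨d, hd⟩ := exists_isMaxDiv S x
    obtain ⟨y, hy⟩ := hd.rdvd
    exact ⟨y, d, hy, hd⟩
  choose y d hyd hd using h
  let R : ℕ → ArtinMonoid := fun j => Nat.rec x (fun j r => y (T j) r) j
  exact ⟨R, fun j => d (T j) (R j), rfl, fun j => hyd (T j) (R j), fun j => hd (T j) (R j)⟩

/-- From index `n - 2` on the letter sets alternate between I and J, whose union contains every
generator. -/
theorem mem_codeLetters_or {n : ℕ} (hn : 3 ≤ n) {i j : ℕ} (hi : i ∈ Set.Ico 1 n)
    (hj : n - 2 ≤ j) : i ∈ codeLetters n j ∨ i ∈ codeLetters n (j + 1) := by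
  obtain ⟨k, rfl⟩ : ∃ k, j = n - 2 + k := ⟨j - (n - 2), by omega⟩
  rw [add_assoc, codeLetters_add, codeLetters_add, blockLetters, blockLetters]
  rw [Set.mem_Ico] at hi
  by_cases h : Odd k
  · have h' : ¬ Odd (k + 1) := by rw [Nat.not_odd_iff_even]; exact h.add_one
    rw [if_pos h, if_neg h', Set.mem_Ico, Set.mem_Ico]
    omega
  · have h' : Odd (k + 1) := (Nat.not_odd_iff_even.1 h).add_one
    rw [if_neg h, if_pos h', Set.mem_Ico, Set.mem_Ico]
    omega

/-- The greedy decomposition along the blocks of a code terminates. -/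
theorem exists_rest_eq_one {n : ℕ} (hn : 3 ≤ n) {R G : ℕ → ArtinMonoid}
    (hR : ∀ j, R j = R (j + 1) * G j) (hmax : ∀ j, IsMaxDiv (codeLetters n j) (R j) (G j))
    (hon : ∀ j, On (Set.Ico 1 n) (R j)) : ∃ K, R K = 1 := by
  have key : ∀ L j, n - 2 ≤ j → len (R j) ≤ L → ∃ K, R K = 1 := by
    intro L
    induction L with
    | zero => exact fun j _ h => ⟨j, eq_one_of_len (by omega)⟩
    | succ L ih =>
      intro j hj hL
      rcases eq_one_or_mul_gen (R j) with h | ⟨y, i, h⟩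
      · exact ⟨j, h⟩
      have hi : i ∈ Set.Ico 1 n := by
        have := hon j
        rw [h, on_mul, on_gen] at this
        exact this.2
      have hl := congrArg len (hR j)
      have hl' := congrArg len (hR (j + 1))
      rw [len_mul] at hl hl'
      have hpos : ∀ k, i ∈ codeLetters n k → RDvd (gen i) (R k) → 1 ≤ len (G k) := by
        intro k hk hd
        obtain ⟨z, hz⟩ := (hmax k).max (gen i) (on_gen.2 hk) hd
        rw [hz, len_mul, len_gen]
        omega
      -- A last letter of `R j` is allowed in one of the next two blocks, so two steps remove at
      -- least one letter.
      refine ih (j + 2) (by omega) ?_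
      change len (R (j + 1 + 1)) ≤ L
      rcases mem_codeLetters_or hn hi hj with h1 | h1
      · have := hpos j h1 ⟨y, h⟩
        omega
      · rcases Nat.eq_zero_or_pos (len (G j)) with h0 | h0
        · have e := hR j
          rw [eq_one_of_len h0, mul_one] at e
          have := hpos (j + 1) h1 ⟨y, by rw [← e, h]⟩
          omega
        · omega
  exact key _ (n - 2) le_rfl le_rfl

theorem codeLetters_mono {n : ℕ} (hn : 3 ≤ n) {j : ℕ} (hj : j < n - 2) {k : ℕ} (hk : k ≤ n - 2)
    (hjk : j ≤ k) : codeLetters n j ⊆ codeLetters n k := by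
  intro i hi
  rw [codeLetters, if_pos hj, Set.mem_Ico] at hi
  unfold codeLetters blockLetters
  split_ifs with h1 h2
  · rw [Set.mem_Ico]; omega
  · rw [show k - (n - 2) = 0 by omega] at h2; simp at h2
  · rw [Set.mem_Ico]; omega

/-! ### The greatest form, by induction on the number of strands -/

/-- The word `w` is the alternating normal form of `x`, and its code `c` is the greatest among all
codes of all words that represent right divisors of `x`. -/
structure IsGreatestForm (n : ℕ) (x : ArtinMonoid) (w : BraidWord) (c : BraidCode) : Prop where
  lettersIn : w.LettersIn (Set.Ico 1 n)
  eq : ofWord w = x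
  phi : IsPhiNormalForm n (wordBraid n w) w
  code : HasCode n (dehornoyDiagram n) w c
  max : ∀ v c', v.LettersIn (Set.Ico 1 n) → HasCode n (dehornoyDiagram n) v c' →
    RDvd (ofWord v) x → c' = c ∨ BraidCode.LtRight c' c

theorem isGreatestForm_two {u : BraidWord} (hu : u.LettersIn (Set.Ico 1 2)) :
    IsGreatestForm 2 (ofWord u) u (BraidCode.exp u.length) := by
  have e : ∀ v : BraidWord, v.LettersIn (Set.Ico 1 2) → v = List.replicate v.length 1 :=
    fun v hv => List.eq_replicate_of_mem fun l hl => by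
      have := hv l hl
      rw [Set.mem_Ico] at this
      omega
  refine ⟨hu, rfl, ?_, hasCode_two.2 ⟨_, e u hu, rfl⟩, ?_⟩
  · have := IsPhiNormalForm.two u.length
    rw [← e u hu] at this
    convert this
    rw [e u hu]
    simp [wordBraid]
  · rintro v c' hv hc ⟨y, hy⟩
    obtain ⟨a, rfl, rfl⟩ := hasCode_two.1 hc
    have hl := congrArg len hy
    rw [len_mul, len_ofWord, len_ofWord, List.length_replicate] at hl
    rcases Nat.lt_or_ge a u.length with h | h
    · exact Or.inr (BraidCode.LtRight.exp h)
    · left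
      congr 1
      omega

/-- Greatest forms carried back to the letters of a block. -/
theorem exists_block_form {f g : ℕ → ℕ} {S : Set ℕ} {N : ℕ} (h : LetterIso f g S (Set.Ico 1 N))
    (ih : ∀ x, On (Set.Ico 1 N) x → ∃ w c, IsGreatestForm N x w c) {x : ArtinMonoid}
    (hx : On S x) : ∃ (w : BraidWord) (c : BraidCode), ofWord w = x ∧
      IsPhiNormalForm N (wordBraid N (w.map f)) (w.map f) ∧
      HasCode N (dehornoyDiagram N) (w.map f) c ∧
      ∀ (v : BraidWord) (c' : BraidCode), v.LettersIn S →
        HasCode N (dehornoyDiagram N) (v.map f) c' → RDvd (ofWord v) x →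
          c' = c ∨ BraidCode.LtRight c' c := by
  obtain ⟨u, rfl⟩ := exists_ofWord x
  have hu := on_ofWord.1 hx
  obtain ⟨w, c, hw⟩ := ih (ofWord (u.map f)) (on_ofWord.2 (h.map_lettersIn hu))
  have e : (w.map g).map f = w := h.symm.map_map hw.lettersIn
  refine ⟨w.map g, c, ?_, ?_, ?_, ?_⟩
  · rw [ofWord_map h.compat' hw.lettersIn hw.eq, h.map_map hu]
  · rw [e]; exact hw.phi
  · rw [e]; exact hw.code
  · rintro v c' hv hc ⟨y, hy⟩
    obtain ⟨y, rfl⟩ := exists_ofWord y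
    rw [← ofWord_append] at hy
    have := ofWord_map h.compat hu hy
    rw [List.map_append, ofWord_append] at this
    exact hw.max _ c' (h.map_lettersIn hv) hc ⟨_, this⟩

theorem exists_stack_suffix {v : ℕ → BraidWord} {K : ℕ} (hK : ∀ j, K ≤ j → v j = []) (k : ℕ) :
    ∃ t, stack v K = t ++ stack v k := by
  rcases le_total k K with h | h
  · obtain ⟨b, rfl⟩ := Nat.exists_eq_add_of_le h
    exact ⟨_, stack_add v k b⟩
  · exact ⟨[], by rw [stack_eq_of_empty h fun j h1 _ => hK j h1, List.nil_append]⟩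

theorem mul_ofWord_stack {R G : ℕ → ArtinMonoid} {w : ℕ → BraidWord}
    (hR : ∀ j, R j = R (j + 1) * G j) (hw : ∀ j, ofWord (w j) = G j) (j : ℕ) :
    R 0 = R j * ofWord (stack w j) := by
  induction j with
  | zero => simp [stack]
  | succ j ih => rw [ih, hR j, stack, ofWord_append, hw, mul_assoc]

/-- The first `n - 1` greedy blocks together form block 0 of the alternate decomposition; each later
greedy block is one of its blocks. -/
theorem isPhiNormalForm_of_greedy {n : ℕ} (hn : 3 ≤ n) {R G : ℕ → ArtinMonoid}
    {w : ℕ → BraidWord} (hR : ∀ j, R j = R (j + 1) * G j)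
    (hmax : ∀ j, IsMaxDiv (codeLetters n j) (R j) (G j)) (hon : ∀ j, On (Set.Ico 1 n) (R j))
    (hw : ∀ j, ofWord (w j) = G j)
    (hphi : ∀ j, IsPhiNormalForm (codeStrands n j)
      (wordBraid (codeStrands n j) ((w j).map (codeMap n j))) ((w j).map (codeMap n j)))
    {K : ℕ} (hK : ∀ j, K ≤ j → R j = 1) :
    IsPhiNormalForm n (wordBraid n (stack w K)) (stack w K) := by
  have hwS : ∀ j, (w j).LettersIn (codeLetters n j) := fun j =>
    on_ofWord.1 (by rw [hw]; exact (hmax j).on)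
  have hnil : ∀ j, K ≤ j → w j = [] := fun j hj => by
    have := hR j
    rw [hK j hj] at this
    exact eq_nil_of_ofWord_eq_one ((hw j).trans (eq_one_of_mul_eq_one this.symm).2)
  have hrest : ∀ j d, On (codeLetters n j) d → RDvd d (R (j + 1)) → d = 1 := fun j => by
    have := hmax j
    rw [hR j] at this
    exact this.rest
  choose r hr using fun j => exists_ofWord (R j)
  -- Blocks `n - 3` and `n - 2`, that is X_1 and A_0, have the same letters, so the first of them
  -- leaves nothing to the second.
  have hmid : w (n - 2) = [] := by
    refine eq_nil_of_ofWord_eq_one (hrest (n - 3) _ ?_ ?_)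
    · have := hwS (n - 2)
      rw [on_ofWord]
      refine this.mono fun l hl => ?_
      rw [← add_zero (n - 2), codeLetters_add] at hl
      rw [codeLetters, if_pos (by omega), Set.mem_Ico]
      simp only [blockLetters, Nat.not_odd_zero, if_false, Set.mem_Ico] at hl
      omega
    · rw [show n - 3 + 1 = n - 2 by omega, hw]
      exact (hmax _).rdvd
  have hlow : ∀ j < n - 2, codeLetters n j = Set.Ico (n - 1 - j) n ∧ codeStrands n j = j + 2 ∧
      ∀ v : BraidWord, v.map (codeMap n j) = shiftWord (n - 2 - j) v := fun j hj =>
    ⟨if_pos hj, if_pos hj, fun v => by rw [codeMap, if_pos hj]; rfl⟩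
  have hstack := isPhiNormalForm_stack (n := n) (w := w)
    (fun j hj => by rw [← (hlow j hj).1]; exact hwS j)
    (fun j hj => by
      have := hphi j
      rwa [(hlow j hj).2.1, (hlow j hj).2.2] at this)
    (fun j hj d hd hdv => hrest j d (by rwa [(hlow j (by omega)).1])
      (hdv.trans (by rw [hw]; exact (hmax _).rdvd))) (n - 3) (by omega)
  rw [show n - 3 + 2 = n - 1 by omega, show n - 3 + 1 = n - 2 by omega,
    show n - 2 - (n - 3) = 1 by omega] at hstack
  let w' : ℕ → BraidWord := fun i => if i = 0 then stack w (n - 1) else w (n - 2 + i)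
  let ρ : ℕ → BraidWord := fun i => if i = 0 then stack w K else r (n - 2 + i)
  have hsucc : stack w (n - 1) = stack w (n - 2) := by
    rw [show n - 1 = n - 2 + 1 by omega, stack, hmid, List.nil_append]
  have h0 : ofWord (stack w K) = R 0 := by
    rw [mul_ofWord_stack hR hw K, hK K le_rfl, one_mul]
  have e : stack w K = concatBlocks w' K := by
    rw [concatBlocks_eq_stack, ← stack_eq_of_empty (show K ≤ n - 1 + K by omega)
      fun j h _ => hnil j h, stack_add, add_comm K 1, stack_add w']
    congr 1
    · refine stack_congr fun i _ => ?_
      simp only [w', if_neg (show ¬ 1 + i = 0 by omega)]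
      congr 1
      omega
    · simp [stack, w']
  have halt : IsAlternateDecomposition n (wordBraid n (stack w K)) K
      (fun i => wordBraid n (w' i)) := by
    refine isAlternateDecomposition_of_isMaxDiv (r := ρ) ?_ ?_ ?_ ?_
    · intro i
      rw [← on_ofWord]
      cases i with
      | zero => simpa [ρ, h0] using hon 0
      | succ i => simpa [ρ, hr] using hon _
    · intro i
      cases i with
      | zero =>
        have hS : On (codeLetters n (n - 2)) (ofWord (stack w (n - 2))) :=
          on_ofWord.2 (stack_lettersIn fun j hj =>
            (hwS j).mono (codeLetters_mono hn hj le_rfl hj.le))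
        -- The maximal divisor of `R (n - 2)` in I is trivial, and multiplying by the stack, whose
        -- letters lie in I, makes this stack the maximal divisor of `R 0`.
        have := (hmax (n - 2)).mul hS
        rw [← mul_ofWord_stack hR hw, ← hw, hmid, ofWord_nil, one_mul, ← add_zero (n - 2),
          codeLetters_add] at this
        simpa [ρ, w', h0, hsucc] using this
      | succ i =>
        have := hmax (n - 2 + (i + 1))
        rw [codeLetters_add] at this
        simpa [ρ, w', hr, hw] using this
    · intro i
      cases i with
      | zero =>
        simp only [ρ, w', if_true, h0, zero_add, one_ne_zero, if_false, hr]
        rw [mul_ofWord_stack hR hw (n - 1), show n - 2 + 1 = n - 1 by omega]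
      | succ i =>
        simp only [ρ, w', Nat.add_eq_zero_iff, one_ne_zero, and_false, if_false, hr, hw]
        exact hR _
    · simp only [ρ, Nat.add_eq_zero_iff, one_ne_zero, and_false, if_false, hr]
      exact hK _ (by omega)
  have key : IsPhiNormalForm n (wordBraid n (stack w K)) (concatBlocks w' K) := by
    refine IsPhiNormalForm.step n hn _ K _ w' halt (fun i _ => ⟨?_, rfl⟩) ?_
    · cases i with
      | zero =>
        simp only [w', if_true, hsucc]
        rw [← codeLetters_add]
        exact stack_lettersIn fun j hj => (hwS j).mono (codeLetters_mono hn hj le_rfl hj.le)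
      | succ i =>
        have := hwS (n - 2 + (i + 1))
        rwa [codeLetters_add] at this
    · intro i _
      cases i with
      | zero => simpa [w', hsucc, blockToLower] using hstack
      | succ i =>
        have := hphi (n - 2 + (i + 1))
        rw [codeStrands_add] at this
        rw [blockToLower_eq_map]
        exact this
  rwa [← e] at key

theorem exists_isGreatestForm {n : ℕ} (hn : 2 ≤ n) :
    ∀ x, On (Set.Ico 1 n) x → ∃ w c, IsGreatestForm n x w c := by
  induction n using Nat.strong_induction_on with
  | _ n ih =>
  intro x hx
  rcases hn.eq_or_lt with rfl | hn
  · obtain ⟨u, rfl⟩ := exists_ofWord x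
    exact ⟨_, _, isGreatestForm_two (on_ofWord.1 hx)⟩
  obtain ⟨R, G, rfl, hR, hmax⟩ := exists_greedy (codeLetters n) x
  have hon : ∀ j, On (Set.Ico 1 n) (R j) := by
    intro j
    induction j with
    | zero => exact hx
    | succ j ihj =>
      rw [hR j, on_mul] at ihj
      exact ihj.1
  have hform : ∀ j, ∃ (w : BraidWord) (c : BraidCode), ofWord w = G j ∧
      IsPhiNormalForm (codeStrands n j) (wordBraid (codeStrands n j) (w.map (codeMap n j)))
        (w.map (codeMap n j)) ∧
      HasCode (codeStrands n j) (dehornoyDiagram (codeStrands n j)) (w.map (codeMap n j)) c ∧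
      ∀ (v : BraidWord) (c' : BraidCode), v.LettersIn (codeLetters n j) →
        HasCode (codeStrands n j) (dehornoyDiagram (codeStrands n j)) (v.map (codeMap n j)) c' →
          RDvd (ofWord v) (G j) → c' = c ∨ BraidCode.LtRight c' c := fun j => by
    obtain ⟨g, hg⟩ := codeMap_letterIso hn j
    exact exists_block_form hg (ih _ (codeStrands_lt hn j) (two_le_codeStrands hn j)) (hmax j).on
  choose w c hw hphi hcode hgreat using hform
  obtain ⟨K, hK0⟩ := exists_rest_eq_one hn hR hmax hon
  have hK : ∀ j, K ≤ j → R j = 1 := fun j hj => by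
    induction j, hj using Nat.le_induction with
    | base => exact hK0
    | succ j _ ihj => exact (eq_one_of_mul_eq_one ((hR j).symm.trans ihj)).1
  have hwS : ∀ j, (w j).LettersIn (codeLetters n j) := fun j =>
    on_ofWord.1 (by rw [hw]; exact (hmax j).on)
  have hnil : ∀ j, K ≤ j → w j = [] := fun j hj => by
    have := hR j
    rw [hK j hj] at this
    exact eq_nil_of_ofWord_eq_one ((hw j).trans (eq_one_of_mul_eq_one this.symm).2)
  refine ⟨stack w K, BraidCode.seq c,
    stack_lettersIn fun j _ => (hwS j).mono (codeLetters_subset hn j), ?_,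
    isPhiNormalForm_of_greedy hn hR hmax hon hw hphi hK,
    (hasCode_iff_blocks hn).2 ⟨w, c, K, rfl, rfl, hnil, hwS, hcode⟩, ?_⟩
  · rw [mul_ofWord_stack hR hw K, hK0, one_mul]
  · rintro v C - hC ⟨y, hy⟩
    obtain ⟨v, c', K', rfl, rfl, hK', hv, hvc⟩ := (hasCode_iff_blocks hn).1 hC
    by_cases hcc : c' = c
    · exact Or.inl (congrArg _ hcc)
    right
    classical
    have hex : ∃ l, c' l ≠ c l := Function.ne_iff.1 hcc
    have hlt : ∀ i < Nat.find hex, c' i = c i := fun i hi => not_not.1 (Nat.find_min hex hi)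
    -- At the rightmost difference the hypothesis on fewer strands applies as soon as the competing
    -- block is known to divide the greedy remainder; maximality then makes it divide the greedy
    -- block.
    refine BraidCode.LtRight.seq (Nat.find hex) hlt ?_
    refine (hgreat _ _ _ (hv _) (hvc _) ((hmax _).max _ (on_ofWord.2 (hv _)) ?_)).resolve_left
      (Nat.find_spec hex)
    generalize Nat.find hex = l at hlt
    have hst : stack v l = stack w l := stack_congr fun i hi => by
      obtain ⟨g, hg⟩ := codeMap_letterIso hn i
      refine hg.map_injective (hv i) (hwS i) ?_
      have := hvc i
      rw [hlt i hi] at this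
      exact this.word_unique (two_le_codeStrands hn i) (hcode i)
    obtain ⟨t, ht⟩ := exists_stack_suffix hK' (l + 1)
    -- The common blocks to the right of `l` are split off on both sides and cancelled, leaving the
    -- block `v l` as a right divisor of `R l`.
    rw [ht, stack, hst, ofWord_append, ofWord_append, ← mul_assoc, ← mul_assoc,
      mul_ofWord_stack hR hw l] at hy
    exact ⟨_, mul_right_cancel hy⟩

/-- Every positive braid has exactly one `𝒞`-normal form with respect to the Dehornoy ordering and
exactly one `Φ`-normal form, and these are the same word. -/
theorem mainTheorem4 (n : ℕ) (hn : 2 ≤ n) (β : BraidGroup n) (hβ : β ∈ positiveBraidMonoid n) :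
    ∃ w : BraidWord,
      (∀ v : BraidWord, IsCNormalForm n (dehornoyDiagram n) β v ↔ v = w) ∧
      (∀ v : BraidWord, IsPhiNormalForm n β v ↔ v = w) := by
  obtain ⟨u, hu, rfl⟩ := mem_parabolicMonoid_iff.1 hβ
  obtain ⟨w, c, hw⟩ := exists_isGreatestForm hn (ofWord u) (on_ofWord.2 hu)
  have e : wordBraid n w = wordBraid n u := (wordBraid_eq_iff hw.lettersIn hu).2 hw.eq
  have hmax : ∀ v c', IsPositiveRep n (wordBraid n u) v → HasCode n (dehornoyDiagram n) v c' →
      c' = c ∨ BraidCode.LtRight c' c := fun v c' hv hc =>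
    -- A word for the braid itself is the case of a right divisor with quotient 1.
    hw.max v c' hv.1 hc ⟨1, by rw [one_mul, (wordBraid_eq_iff hv.1 hu).1 hv.2]⟩
  have hphi := hw.phi
  rw [e] at hphi
  refine ⟨w, fun v => ⟨?_, ?_⟩, fun v => ⟨fun h => h.unique hn hphi, ?_⟩⟩
  · rintro ⟨c', hv, hc, hgreat⟩
    have hcc : c' = c := by
      rcases hmax v c' hv hc with h | h
      · exact h
      · rcases hgreat w c ⟨hw.lettersIn, e⟩ hw.code with h' | h'
        · exact h'.symm
        · exact absurd h' h.asymm
    exact hc.word_unique hn (hcc ▸ hw.code)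
  · rintro rfl
    exact ⟨c, ⟨hw.lettersIn, e⟩, hw.code, hmax⟩
  · rintro rfl
    exact hphi
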